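/- Let $FV(\mathbb{R}^2)$ be the space of all $f\in L^2(\mathbb{R}^2)$ (real-valued functions modulo equality almost everywhere) whose variation $$V(f)=\sup\Big\{\int_{\mathbb{R}^2} f\,\operatorname{div}\Phi\,dx \;:\; \Phi\in C_c^\infty(\mathbb{R}^2;\mathbb{R}^2),\ |\Phi(x)|\le 1 \text{ for all } x\Big\}$$ is finite, normed by $\|f\|_{FV}=V(f)$. Let $\mathcal{J}(\mathbb{R}^2)$ be the space of all finite $\mathbb{R}^2$-valued Borel measures $\mu$ on $\mathbb{R}^2$ that are divergence-free in the sense of distributions, that is, $\int_{\mathbb{R}^2} \nabla\varphi\cdot d\mu=0$ for all $\varphi\in C_c^\infty(\mathbb{R}^2)$, normed by the total variation $\|\mu\|_{\mathcal J}=|\mu|(\mathbb{R}^2)$ (taken with respect to the Euclidean norm on $\mathbb{R}^2$). Then for every $f\in FV(\mathbb{R}^2)$ there is exactly one finite $\mathbb{R}^2$-valued Borel measure $\nabla^\perp f=\mu=(\mu_1,\mu_2)$ with $\mu_1=-\partial_2 f$ and $\mu_2=\partial_1 f$ in the sense of distributions, that is, $$\int\varphi\,d\mu_1=\int f\,\partial_2\varphi\,dx,\qquad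 \int\varphi\,d\mu_2=-\int f\,\partial_1\varphi\,dx\qquad\text{for all }\varphi\in C_c^\infty(\mathbb{R}^2);$$ it belongs to $\mathcal{J}(\mathbb{R}^2)$, and the map $f\mapsto\nabla^\perp f$ is an isometric linear isomorphism from $FV(\mathbb{R}^2)$ onto $\mathcal{J}(\mathbb{R}^2)$. -/

import Mathlib

open MeasureTheory Set Filter
open scoped ENNReal ContDiff

noncomputable section

/-- The Euclidean plane `ℝ²`. -/
abbrev Plane : Type := EuclideanSpace ℝ (Fin 2)

/-- The partial derivative `∂_i φ` of a scalar function (indices `0, 1` stand for `1, 2`). -/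
def partialD (i : Fin 2) (φ : Plane → ℝ) (x : Plane) : ℝ :=
  fderiv ℝ φ x (EuclideanSpace.single i 1)

/-- The divergence `∂_1 Φ_1 + ∂_2 Φ_2` of a vector field. -/
def divergence (Φ : Plane → Plane) (x : Plane) : ℝ :=
  ∑ i : Fin 2, fderiv ℝ Φ x (EuclideanSpace.single i 1) i

/-- `Φ ∈ C_c^∞(ℝ²; ℝ²)` with `‖Φ‖_∞ ≤ 1`. -/
structure IsAdmissible (Φ : Plane → Plane) : Prop where
  smooth : ContDiff ℝ ∞ Φ
  compact : HasCompactSupport Φ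
  bound : ∀ x, ‖Φ x‖ ≤ 1

/-- The variation `V(f) = sup {∫ f div Φ : Φ ∈ C_c^∞(ℝ²; ℝ²), ‖Φ‖_∞ ≤ 1} ∈ [0, ∞]` of a locally
integrable function. As `Φ = 0` is admissible, truncating the integrals at `0` does not change
the supremum. -/
def planeVariation (f : Plane → ℝ) : ℝ≥0∞ :=
  ⨆ (Φ : Plane → Plane) (_ : IsAdmissible Φ), ENNReal.ofReal (∫ x, f x * divergence Φ x)

/-! ### Elementary properties of the variation -/

lemma continuous_divergence {Φ : Plane → Plane} (h : ContDiff ℝ ∞ Φ) :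
    Continuous (divergence Φ) := by
  have := h.continuous_fderiv (by simp)
  unfold divergence
  fun_prop

lemma hasCompactSupport_divergence {Φ : Plane → Plane} (h : HasCompactSupport Φ) :
    HasCompactSupport (divergence Φ) := by
  refine (h.fderiv (𝕜 := ℝ)).mono ?_
  intro x hx
  contrapose! hx
  simp only [Function.mem_support, ne_eq, not_not] at hx ⊢
  simp [divergence, hx]

lemma locallyIntegrable_Lp_two (f : Lp ℝ 2 (volume : Measure Plane)) :
    LocallyIntegrable f volume :=
  (Lp.memLp f).locallyIntegrable (by norm_num)

lemma integrable_mul_divergence (f : Lp ℝ 2 (volume : Measure Plane)) {Φ : Plane → Plane}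
    (h : IsAdmissible Φ) : Integrable (fun x => f x * divergence Φ x) := by
  simpa [mul_comm] using (locallyIntegrable_Lp_two f).integrable_smul_right_of_hasCompactSupport
    (continuous_divergence h.smooth) (hasCompactSupport_divergence h.compact)

lemma isAdmissible_neg {Φ : Plane → Plane} (h : IsAdmissible Φ) : IsAdmissible (-Φ) :=
  ⟨h.smooth.neg, by simpa [HasCompactSupport, tsupport, Function.support_neg] using h.compact,
    by simpa using h.bound⟩

lemma divergence_neg (Φ : Plane → Plane) (x : Plane) :
    divergence (-Φ) x = -divergence Φ x := by
  simp [divergence, fderiv_neg]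

lemma ofReal_integral_le_planeVariation (f : Plane → ℝ) {Φ : Plane → Plane}
    (h : IsAdmissible Φ) : ENNReal.ofReal (∫ x, f x * divergence Φ x) ≤ planeVariation f :=
  le_iSup₂_of_le Φ h le_rfl

lemma ofReal_abs_integral_le_planeVariation (f : Plane → ℝ) {Φ : Plane → Plane}
    (h : IsAdmissible Φ) : ENNReal.ofReal |∫ x, f x * divergence Φ x| ≤ planeVariation f := by
  rcases abs_choice (∫ x, f x * divergence Φ x) with h' | h' <;> rw [h']
  · exact ofReal_integral_le_planeVariation f h
  · refine le_trans (le_of_eq ?_) (ofReal_integral_le_planeVariation f (isAdmissible_neg h))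
    simp [divergence_neg, integral_neg]

lemma planeVariation_congr {f g : Plane → ℝ} (h : f =ᵐ[volume] g) :
    planeVariation f = planeVariation g := by
  unfold planeVariation
  refine iSup_congr fun Φ => iSup_congr fun _ => congrArg ENNReal.ofReal (integral_congr_ae ?_)
  filter_upwards [h] with x hx
  rw [hx]

lemma planeVariation_zero : planeVariation 0 = 0 := by
  simp [planeVariation]

lemma planeVariation_add_le (f g : Lp ℝ 2 (volume : Measure Plane)) :
    planeVariation ⇑(f + g) ≤ planeVariation f + planeVariation g := by
  rw [planeVariation_congr (Lp.coeFn_add f g)]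
  refine iSup₂_le fun Φ h => ?_
  have : ∫ x, (⇑f + ⇑g) x * divergence Φ x
      = (∫ x, f x * divergence Φ x) + ∫ x, g x * divergence Φ x := by
    rw [← integral_add (integrable_mul_divergence f h) (integrable_mul_divergence g h)]
    simp [add_mul]
  rw [this]
  exact ENNReal.ofReal_add_le.trans (add_le_add (ofReal_integral_le_planeVariation f h)
    (ofReal_integral_le_planeVariation g h))

lemma planeVariation_smul_le (c : ℝ) (f : Lp ℝ 2 (volume : Measure Plane)) :
    planeVariation ⇑(c • f) ≤ ENNReal.ofReal |c| * planeVariation f := by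
  rw [planeVariation_congr (Lp.coeFn_smul c f)]
  refine iSup₂_le fun Φ h => ?_
  have : ∫ x, (c • ⇑f) x * divergence Φ x = c * ∫ x, f x * divergence Φ x := by
    rw [← integral_const_mul]
    simp [mul_assoc]
  rw [this]
  refine (ENNReal.ofReal_le_ofReal (le_abs_self _)).trans ?_
  rw [abs_mul, ENNReal.ofReal_mul (abs_nonneg c)]
  gcongr
  exact ofReal_abs_integral_le_planeVariation f h

lemma planeVariation_smul (c : ℝ) (f : Lp ℝ 2 (volume : Measure Plane)) :
    planeVariation ⇑(c • f) = ENNReal.ofReal |c| * planeVariation f := by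
  refine le_antisymm (planeVariation_smul_le c f) ?_
  rcases eq_or_ne c 0 with rfl | hc
  · simp
  have h := planeVariation_smul_le c⁻¹ (c • f)
  rw [smul_smul, inv_mul_cancel₀ hc, one_smul] at h
  refine (mul_le_mul_right h (ENNReal.ofReal |c|)).trans ?_
  rw [← mul_assoc, ← ENNReal.ofReal_mul (abs_nonneg c), ← abs_mul, mul_inv_cancel₀ hc]
  simp

/-! ### The variation is definite on `L²(ℝ²)` -/

lemma integral_mul_fderiv_eq_zero {f : Plane → ℝ} (hf : planeVariation f = 0)
    {φ : Plane → ℝ} (hφ : ContDiff ℝ ∞ φ) (hc : HasCompactSupport φ) (v : Plane) :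
    ∫ x, f x * fderiv ℝ φ x v = 0 := by
  obtain ⟨C, hC⟩ := hc.exists_bound_of_continuous hφ.continuous
  have hC0 : 0 ≤ C := (norm_nonneg _).trans (hC 0)
  set c : ℝ := ((C + 1) * (‖v‖ + 1))⁻¹ with hcdef
  have hpos : 0 < (C + 1) * (‖v‖ + 1) := by positivity
  have hcpos : 0 < c := by positivity
  have hadm : IsAdmissible (fun x => φ x • (c • v)) := by
    refine ⟨hφ.smul contDiff_const, hc.smul_right, fun x => ?_⟩
    rw [norm_smul, norm_smul, Real.norm_of_nonneg hcpos.le]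
    calc ‖φ x‖ * (c * ‖v‖) ≤ (C + 1) * (c * (‖v‖ + 1)) := by
          gcongr
          · linarith [hC x]
          · linarith
      _ = c * ((C + 1) * (‖v‖ + 1)) := by ring
      _ = 1 := inv_mul_cancel₀ hpos.ne'
  have hdiv : ∀ x, divergence (fun x => φ x • (c • v)) x = c * fderiv ℝ φ x v := by
    intro x
    have hd : DifferentiableAt ℝ φ x := hφ.differentiable (by simp) x
    have hv : v = ∑ i : Fin 2, v i • EuclideanSpace.single i (1 : ℝ) := by
      ext j; fin_cases j <;> simp
    have hs : fderiv ℝ φ x v = ∑ i : Fin 2, v i * fderiv ℝ φ x (EuclideanSpace.single i 1) := by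
      conv_lhs => rw [hv]
      simp
    rw [hs, divergence, (hd.hasFDerivAt.smul_const (c • v)).fderiv]
    simp
    ring
  have h := ofReal_abs_integral_le_planeVariation f hadm
  rw [hf, nonpos_iff_eq_zero, ENNReal.ofReal_eq_zero] at h
  have h0 : ∫ x, f x * divergence (fun x => φ x • (c • v)) x = 0 :=
    abs_eq_zero.1 (le_antisymm h (abs_nonneg _))
  have h1 : c * ∫ x, f x * fderiv ℝ φ x v = 0 := by
    rw [← h0, ← integral_const_mul]
    refine integral_congr_ae (Eventually.of_forall fun x => ?_)
    simp only [hdiv]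
    ring
  exact (mul_eq_zero.1 h1).resolve_left hcpos.ne'

/-- If the variation vanishes, integrals against translated test functions do not depend on the
translation. -/
lemma integral_mul_translate_eq {f : Lp ℝ 2 (volume : Measure Plane)}
    (hf : planeVariation f = 0) {g : Plane → ℝ} (hg : ContDiff ℝ ∞ g)
    (hc : HasCompactSupport g) (x y : Plane) :
    ∫ t, f t * g (x - t) = ∫ t, f t * g (y - t) := by
  have hder : ∀ z, HasFDerivAt
      (MeasureTheory.convolution f g (ContinuousLinearMap.lsmul ℝ ℝ) volume)
      (MeasureTheory.convolution f (fderiv ℝ g)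
        ((ContinuousLinearMap.lsmul ℝ ℝ).precompR Plane) volume z) z := fun z =>
    hc.hasFDerivAt_convolution_right _ (locallyIntegrable_Lp_two f) (hg.of_le (by simp)) z
  have hzero : ∀ z, MeasureTheory.convolution f (fderiv ℝ g)
      ((ContinuousLinearMap.lsmul ℝ ℝ).precompR Plane) volume z = 0 := by
    intro z
    ext v
    rw [convolution_precompR_apply _ (locallyIntegrable_Lp_two f) (hc.fderiv ℝ)
      (hg.continuous_fderiv (by simp))]
    have hφ : ContDiff ℝ ∞ (fun t => g (z - t)) := hg.comp (contDiff_const.sub contDiff_id)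
    have hφc : HasCompactSupport (fun t => g (z - t)) :=
      hc.comp_homeomorph (Homeomorph.subLeft z)
    have h := integral_mul_fderiv_eq_zero hf hφ hφc v
    have hfd : ∀ t, fderiv ℝ (fun t => g (z - t)) t v = - fderiv ℝ g (z - t) v := by
      intro t
      have h1 : HasFDerivAt g (fderiv ℝ g (z - t)) (z - t) :=
        (hg.differentiable (by simp) _).hasFDerivAt
      have h2 : HasFDerivAt (fun t : Plane => z - t)
        (-(ContinuousLinearMap.id ℝ Plane)) t := (hasFDerivAt_id t).const_sub z
      have h3 : HasFDerivAt (fun t => g (z - t)) _ t := h1.comp t h2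
      rw [h3.fderiv]
      simp
    simp only [hfd, mul_neg, integral_neg, neg_eq_zero] at h
    simpa [MeasureTheory.convolution] using h
  have hconst := is_const_of_fderiv_eq_zero (𝕜 := ℝ)
    (f := MeasureTheory.convolution f g (ContinuousLinearMap.lsmul ℝ ℝ) volume)
    (fun z => (hder z).differentiableAt) (fun z => by rw [(hder z).fderiv, hzero z]) x y
  simpa [MeasureTheory.convolution] using hconst

lemma integral_mul_reflect_eq_zero {f : Lp ℝ 2 (volume : Measure Plane)}
    (hf : planeVariation f = 0) {g : Plane → ℝ} (hg : ContDiff ℝ ∞ g)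
    (hc : HasCompactSupport g) (x : Plane) : ∫ t, f t * g (x - t) = 0 := by
  have hgL : MemLp g 2 volume := hg.continuous.memLp_of_hasCompactSupport hc
  by_contra hne
  set a : ℝ := |∫ t, f t * g (x - t)| with ha
  have hapos : 0 < a := abs_pos.2 hne
  set M : ℝ := (eLpNorm g 2 volume).toReal with hM
  have hM0 : 0 ≤ M := ENNReal.toReal_nonneg
  set ε : ℝ := a / (2 * (M + 1)) with hε
  have hεpos : 0 < ε := by positivity
  obtain ⟨h, hhc, hhle, hhcont, hhL⟩ := (Lp.memLp f).exists_hasCompactSupport_eLpNorm_sub_le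
    (by norm_num) (ε := ENNReal.ofReal ε) (by simpa using hεpos)
  -- a translation that moves the support of `g` off the support of `h`
  obtain ⟨y, hy⟩ : ∃ y : Plane, ∀ t, h t * g (y - t) = 0 := by
    obtain ⟨R, hR⟩ := hhc.isCompact.isBounded.subset_closedBall 0
    obtain ⟨S, hS⟩ := hc.isCompact.isBounded.subset_closedBall 0
    obtain ⟨y, hy⟩ := NormedSpace.exists_lt_norm ℝ Plane (R + S)
    refine ⟨y, fun t => ?_⟩
    by_contra hcon
    obtain ⟨h1, h2⟩ := mul_ne_zero_iff.1 hcon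
    have h1' := hR (subset_tsupport _ h1)
    have h2' := hS (subset_tsupport _ h2)
    rw [mem_closedBall_zero_iff] at h1' h2'
    have : ‖y‖ ≤ ‖y - t‖ + ‖t‖ := by simpa using norm_add_le (y - t) t
    linarith
  have hmp : MeasurePreserving (fun t : Plane => y - t) volume volume :=
    Measure.measurePreserving_sub_left volume y
  have hgy : MemLp (fun t => g (y - t)) 2 volume := hgL.comp_measurePreserving hmp
  have hnorm : eLpNorm (fun t => g (y - t)) 2 volume = eLpNorm g 2 volume :=
    eLpNorm_comp_measurePreserving hgL.aestronglyMeasurable hmp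
  have hdiff : MemLp (⇑f - h) 2 volume := (Lp.memLp f).sub hhL
  have hle : a ≤ ε * M := by
    have e1 : ∫ t, f t * g (x - t) = ∫ t, (⇑f - h) t * g (y - t) := by
      rw [integral_mul_translate_eq hf hg hc x y]
      refine integral_congr_ae (Eventually.of_forall fun t => ?_)
      simp [sub_mul, hy t]
    rw [ha, e1, ← Real.norm_eq_abs]
    have e2 : eLpNorm (fun t => (⇑f - h) t * g (y - t)) 1 volume
        ≤ ENNReal.ofReal ε * eLpNorm g 2 volume := by
      have := eLpNorm_smul_le_mul_eLpNorm (p := 2) (q := 2) (r := 1) (μ := volume)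
        hgy.aestronglyMeasurable hdiff.aestronglyMeasurable
      refine (this.trans ?_)
      rw [hnorm]
      gcongr
    have e3 : ‖∫ t, (⇑f - h) t * g (y - t)‖ₑ ≤ ENNReal.ofReal ε * eLpNorm g 2 volume := by
      refine (enorm_integral_le_lintegral_enorm _).trans ?_
      rwa [eLpNorm_one_eq_lintegral_enorm] at e2
    have e4 := ENNReal.toReal_mono (ENNReal.mul_ne_top (by simp) hgL.eLpNorm_ne_top) e3
    rwa [toReal_enorm, ENNReal.toReal_mul, ENNReal.toReal_ofReal hεpos.le] at e4
  have hlt : ε * M < a := by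
    rw [hε, div_mul_eq_mul_div, div_lt_iff₀ (by positivity)]
    nlinarith
  linarith

lemma eq_zero_of_planeVariation_eq_zero (f : Lp ℝ 2 (volume : Measure Plane))
    (hf : planeVariation f = 0) : f = 0 := by
  rw [Lp.eq_zero_iff_ae_eq_zero]
  refine ae_eq_zero_of_integral_contDiff_smul_eq_zero (locallyIntegrable_Lp_two f) ?_
  intro g hg hc
  have h := integral_mul_reflect_eq_zero hf (g := fun t => g (-t)) (hg.comp contDiff_neg)
    (hc.comp_homeomorph (Homeomorph.neg Plane)) 0
  simpa [mul_comm] using h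

/-! ### The normed space `FV(ℝ²)` -/

/-- The functions in `L²(ℝ²)` of finite variation, as a linear subspace of `L²(ℝ²)`. -/
def fvSubmodule : Submodule ℝ (Lp ℝ 2 (volume : Measure Plane)) where
  carrier := {f | planeVariation f < ⊤}
  add_mem' {f g} hf hg :=
    (planeVariation_add_le f g).trans_lt (ENNReal.add_lt_top.2 ⟨hf, hg⟩)
  zero_mem' := by
    have : planeVariation ⇑(0 : Lp ℝ 2 (volume : Measure Plane)) = 0 := by
      rw [planeVariation_congr (Lp.coeFn_zero ℝ 2 volume), planeVariation_zero]
    exact this.trans_lt (by simp)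
  smul_mem' c f hf :=
    (planeVariation_smul_le c f).trans_lt (ENNReal.mul_lt_top (by simp) hf)

/-- The space `FV(ℝ²)` of all `f ∈ L²(ℝ²)` with `V(f) < ∞`. It is a type of its own because its
norm is the variation, not the `L²` norm. -/
def FV : Type := fvSubmodule

namespace FV

instance : AddCommGroup FV := inferInstanceAs (AddCommGroup fvSubmodule)
instance : Module ℝ FV := inferInstanceAs (Module ℝ fvSubmodule)

/-- The class in `L²(ℝ²)` of an element of `FV(ℝ²)`. -/
def toL2 : FV →ₗ[ℝ] Lp ℝ 2 (volume : Measure Plane) := fvSubmodule.subtype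

lemma toL2_injective : Function.Injective toL2 := Subtype.val_injective

lemma planeVariation_lt_top (f : FV) : planeVariation (toL2 f) < ⊤ := f.2

/-- The norm `‖f‖_FV = V(f)`. -/
instance : Norm FV := ⟨fun f => (planeVariation (toL2 f)).toReal⟩

lemma norm_def (f : FV) : ‖f‖ = (planeVariation (toL2 f)).toReal := rfl

lemma normedSpaceCore : NormedSpace.Core ℝ FV where
  norm_nonneg _ := ENNReal.toReal_nonneg
  norm_smul c f := by
    rw [norm_def, norm_def, map_smul, planeVariation_smul, ENNReal.toReal_mul,
      ENNReal.toReal_ofReal (abs_nonneg c), Real.norm_eq_abs]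
  norm_triangle f g := by
    rw [norm_def, norm_def, norm_def, map_add, ← ENNReal.toReal_add
      (planeVariation_lt_top f).ne (planeVariation_lt_top g).ne]
    exact ENNReal.toReal_mono (ENNReal.add_lt_top.2
      ⟨planeVariation_lt_top f, planeVariation_lt_top g⟩).ne (planeVariation_add_le _ _)
  norm_eq_zero_iff f := by
    refine ⟨fun h => ?_, ?_⟩
    · rw [norm_def, ENNReal.toReal_eq_zero_iff] at h
      refine toL2_injective ?_
      rw [map_zero]
      exact eq_zero_of_planeVariation_eq_zero _
        (h.resolve_right (planeVariation_lt_top f).ne)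
    · rintro rfl
      rw [norm_def, map_zero, planeVariation_congr (Lp.coeFn_zero ℝ 2 volume),
        planeVariation_zero, ENNReal.toReal_zero]

instance : NormedAddCommGroup FV := NormedAddCommGroup.ofCore normedSpaceCore
instance : NormedSpace ℝ FV := NormedSpace.ofCore normedSpaceCore

end FV

/-! ### Divergence-free vector measures -/

/-- `ℝ²`-valued (countably additive, finite) Borel measures on `ℝ²`. -/
abbrev PlaneMeasure : Type := VectorMeasure Plane Plane

/-- The total variation measure of an `ℝ²`-valued measure is finite. -/
instance isFiniteMeasure_variation (μ : PlaneMeasure) : IsFiniteMeasure μ.variation := by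
  let c : Fin 2 → SignedMeasure Plane := fun i =>
    μ.mapRange (EuclideanSpace.proj (𝕜 := ℝ) i : Plane →L[ℝ] ℝ).toLinearMap.toAddMonoidHom
      (EuclideanSpace.proj (𝕜 := ℝ) i : Plane →L[ℝ] ℝ).continuous
  have hle : μ.variation ≤ (c 0).variation + (c 1).variation := by
    refine VectorMeasure.variation_le_of_forall_enorm_le fun s hs => ?_
    have h0 := VectorMeasure.enorm_measure_le_variation (c 0) s
    have h1 := VectorMeasure.enorm_measure_le_variation (c 1) s
    refine le_trans ?_ (add_le_add h0 h1)
    have e : ∀ i, c i s = μ s i := fun i => rfl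
    have hdec : μ s = (μ s 0) • EuclideanSpace.single (0 : Fin 2) (1 : ℝ)
        + (μ s 1) • EuclideanSpace.single (1 : Fin 2) (1 : ℝ) := by
      ext j; fin_cases j <;> simp
    rw [e, e]
    conv_lhs => rw [hdec]
    refine (enorm_add_le _ _).trans (le_of_eq ?_)
    rw [enorm_smul, enorm_smul]
    simp [enorm_eq_nnnorm]
  have hfin : ∀ i, IsFiniteMeasure (c i).variation := fun i => by
    rw [← SignedMeasure.totalVariation_eq_variation]
    unfold SignedMeasure.totalVariation
    infer_instance
  have := hfin 0
  have := hfin 1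
  exact isFiniteMeasure_of_le _ hle

lemma integrable_gradient (μ : PlaneMeasure) {φ : Plane → ℝ} (hφ : ContDiff ℝ ∞ φ)
    (hc : HasCompactSupport φ) : Integrable (gradient φ) μ.variation := by
  have h1 : Continuous (gradient φ) :=
    (InnerProductSpace.toDual ℝ Plane).symm.continuous.comp (hφ.continuous_fderiv (by simp))
  have h2 : HasCompactSupport (gradient φ) :=
    (hc.fderiv (𝕜 := ℝ)).comp_left (map_zero (InnerProductSpace.toDual ℝ Plane).symm)
  exact h1.integrable_of_hasCompactSupport h2

/-- The distributional divergence `⟨div μ, φ⟩ = -∫ ∇φ · dμ`. -/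
def measureDiv (μ : PlaneMeasure) (φ : Plane → ℝ) : ℝ :=
  -μ.integral (gradient φ) (innerSL ℝ)

/-- The space `𝓙(ℝ²)` of divergence-free `ℝ²`-valued measures on `ℝ²`. -/
def DivFreeMeasure : Submodule ℝ PlaneMeasure where
  carrier := {μ | ∀ φ : Plane → ℝ, ContDiff ℝ ∞ φ → HasCompactSupport φ → measureDiv μ φ = 0}
  add_mem' {μ ν} hμ hν φ hφ hc := by
    have h1 := hμ φ hφ hc
    have h2 := hν φ hφ hc
    unfold measureDiv at *
    rw [VectorMeasure.integral_add_vectorMeasure (integrable_gradient μ hφ hc)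
      (integrable_gradient ν hφ hc)]
    linarith
  zero_mem' φ _ _ := by simp [measureDiv]
  smul_mem' c μ hμ φ hφ hc := by
    have h1 := hμ φ hφ hc
    unfold measureDiv at *
    rw [VectorMeasure.integral_smul_vectorMeasure, ← smul_neg, h1, smul_zero]

namespace DivFreeMeasure

/-- The total variation norm `‖μ‖ = |μ|(ℝ²)`. -/
instance : Norm DivFreeMeasure := ⟨fun μ => (μ : PlaneMeasure).variation.real univ⟩

lemma norm_def (μ : DivFreeMeasure) : ‖μ‖ = (μ : PlaneMeasure).variation.real univ := rfl

lemma normedSpaceCore : NormedSpace.Core ℝ DivFreeMeasure where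
  norm_nonneg _ := measureReal_nonneg
  norm_smul c μ := by
    rw [norm_def, norm_def, Submodule.coe_smul, VectorMeasure.variation_smul]
    rw [measureReal_nnreal_smul_apply, coe_nnnorm]
  norm_triangle μ ν := by
    rw [norm_def, norm_def, norm_def, Submodule.coe_add, ← measureReal_add_apply]
    exact ENNReal.toReal_mono (measure_ne_top _ _) (VectorMeasure.variation_add_le univ)
  norm_eq_zero_iff μ := by
    rw [norm_def, measureReal_eq_zero_iff, Measure.measure_univ_eq_zero,
      VectorMeasure.variation_eq_zero, Submodule.coe_eq_zero]

instance : NormedAddCommGroup DivFreeMeasure := NormedAddCommGroup.ofCore normedSpaceCore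
instance : NormedSpace ℝ DivFreeMeasure := NormedSpace.ofCore normedSpaceCore

end DivFreeMeasure

/-! ### The perpendicular gradient -/

/-- `∇^⊥ f = (-∂_2 f, ∂_1 f) = μ` in the sense of distributions: for every `φ ∈ C_c^∞(ℝ²)`,
`∫ φ dμ_1 = ∫ f ∂_2 φ` and `∫ φ dμ_2 = -∫ f ∂_1 φ`. -/
def IsPerpGradient (f : Plane → ℝ) (μ : PlaneMeasure) : Prop :=
  ∀ φ : Plane → ℝ, ContDiff ℝ ∞ φ → HasCompactSupport φ →
    μ.integral φ (ContinuousLinearMap.lsmul ℝ ℝ) =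
      !₂[∫ x, f x * partialD 1 φ x, -∫ x, f x * partialD 0 φ x]

end

/-! Everything is expressed by one duality. An `ℝ²`-valued measure has the form `μ = g |μ|`
(`PlaneMeasure.exists_density`), and `∇^⊥ f = μ` holds exactly when `∫ f div Φ = ∫ cross Φ g d|μ|`
for all test fields `Φ` (`isPerpGradient_withDensityᵥ_iff`). Up to a rotation by a right angle,
`cross` is the inner product. Hence `V(f) ≤ |μ|(ℝ²)`, and the symmetry of second derivatives makes
`μ` divergence-free.

Existence of `∇^⊥ f` with the opposite inequality: the functional `Φ ↦ ∫ f div Φ` is bounded by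
`V(f) sup |Φ|`. It extends by Hahn–Banach to bounded continuous fields, and
`exists_measure_density_of_strongDual` represents it on compactly supported ones by a measure of
mass at most `V(f)`. That theorem reduces to the scalar case: the absolute value of the functional
`G` is a positive functional on `C_c`, so it is a measure `λ`. From `|G Φ| ≤ ∫ |Φ| dλ` it follows
that `G` is bounded in `L²(λ)`, and the Riesz theorem for Hilbert spaces yields the density.

Surjectivity is the analytic core. It suffices that `|∫ cross Φ g d|μ|| ≤ |μ|(ℝ²) ‖div Φ‖₂` for
divergence-free `μ` (`abs_crossIntegral_le`): then the left side is a bounded functional of `div Φ`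
in `L²`, and its Riesz representative is the required `f`. For the estimate, mollify `μ` to an
integrable divergence-free field `w`. By the Poincaré lemma `w = ∇^⊥ p`, and the planar
Gagliardo–Nirenberg inequality gives a constant `c` with `‖p - c‖₂ ≤ ‖w‖₁ ≤ |μ|(ℝ²)`. Integrate by
parts, apply Cauchy–Schwarz and let the mollifier shrink. -/

noncomputable section

/-! ### Vector measures with density -/

section WithDensity

variable {X E F G : Type*} {mX : MeasurableSpace X}
  [NormedAddCommGroup E] [NormedSpace ℝ E]
  [NormedAddCommGroup F] [NormedSpace ℝ F] [CompleteSpace F]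
  [NormedAddCommGroup G] [NormedSpace ℝ G] [CompleteSpace G]

/-- Integration against a vector measure with a density: `∫ φ d(g λ) = ∫ B φ g dλ`. -/
lemma integral_withDensityᵥ {lam : Measure X} {g : X → F} (hg : Integrable g lam)
    (B : E →L[ℝ] F →L[ℝ] G) {φ : X → E}
    (hφ : Integrable φ (lam.withDensityᵥ g).variation) :
    (lam.withDensityᵥ g).integral φ B = ∫ x, B (φ x) (g x) ∂lam := by
  have hvar := Measure.variation_withDensityᵥ hg
  obtain ⟨g', hg'm, hg'e⟩ := hg.aestronglyMeasurable
  have hwd : lam.withDensity (fun x => ‖g x‖ₑ) = lam.withDensity (fun x => ‖g' x‖ₑ) :=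
    withDensity_congr_ae (hg'e.mono fun x hx => by simp only [hx])
  have hg'meas : Measurable fun x => ‖g' x‖ₑ := hg'm.enorm
  -- null sets of the variation do not see the density
  have hae : ∀ f₁ f₂ : X → E, f₁ =ᵐ[(lam.withDensityᵥ g).variation] f₂ →
      (fun x => B (f₁ x) (g x)) =ᵐ[lam] fun x => B (f₂ x) (g x) := by
    intro f₁ f₂ h
    rw [hvar, hwd] at h
    have h' := (ae_withDensity_iff hg'meas).1 h
    filter_upwards [h', hg'e] with x hx hxe
    -- The variation has density `‖g‖` with respect to `lam`, so equality almost everywhere is known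
    -- only where `g ≠ 0`; elsewhere both sides vanish.
    by_cases h0 : g x = 0
    · simp [h0]
    · rw [hx (by rw [← hxe]; simpa using h0)]
  have hlint : ∀ f : X → E, AEStronglyMeasurable f (lam.withDensityᵥ g).variation →
      ∫⁻ x, ‖f x‖ₑ ∂(lam.withDensityᵥ g).variation = ∫⁻ x, ‖g x‖ₑ * ‖f x‖ₑ ∂lam := by
    intro f hf
    obtain ⟨f', hf'm, hf'e⟩ := hf
    have e1 : ∫⁻ x, ‖f x‖ₑ ∂(lam.withDensityᵥ g).variation
        = ∫⁻ x, ‖f' x‖ₑ ∂(lam.withDensityᵥ g).variation :=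
      lintegral_congr_ae (hf'e.mono fun x hx => by simp only [hx])
    rw [e1, hvar, hwd, lintegral_withDensity_eq_lintegral_mul _ hg'meas hf'm.enorm]
    refine lintegral_congr_ae ?_
    rw [hvar, hwd] at hf'e
    filter_upwards [(ae_withDensity_iff hg'meas).1 hf'e, hg'e] with x hx hxe
    simp only [Pi.mul_apply, hxe]
    by_cases h0 : g' x = 0
    · simp [h0]
    · rw [hx (by simpa using h0)]
  have hint : ∀ f : X → E, Integrable f (lam.withDensityᵥ g).variation →
      Integrable (fun x => B (f x) (g x)) lam := by
    intro f hf
    obtain ⟨f', hf'm, hf'e⟩ := hf.aestronglyMeasurable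
    refine ⟨AEStronglyMeasurable.congr ?_ (hae f f' hf'e).symm, ?_⟩
    · exact B.aestronglyMeasurable_comp₂ hf'm.aestronglyMeasurable hg.aestronglyMeasurable
    · have h2 := hf.2
      rw [HasFiniteIntegral, hlint f hf.1] at h2
      calc ∫⁻ x, ‖B (f x) (g x)‖ₑ ∂lam ≤ ∫⁻ x, ‖B‖ₑ * (‖g x‖ₑ * ‖f x‖ₑ) ∂lam := by
            refine lintegral_mono fun x => ?_
            refine ((B (f x)).le_opENorm (g x)).trans ?_
            rw [mul_comm ‖g x‖ₑ, ← mul_assoc]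
            gcongr
            exact B.le_opENorm (f x)
        _ = ‖B‖ₑ * ∫⁻ x, ‖g x‖ₑ * ‖f x‖ₑ ∂lam := lintegral_const_mul' _ _ (by simp)
        _ < ⊤ := ENNReal.mul_lt_top (by simp) h2
  -- Both sides are additive, agree on indicators, and are continuous for the `L¹` norm of the
  -- variation; for the right side this norm is the integral of `‖g‖ ‖f‖` against `lam`.
  refine Integrable.induction
    (P := fun f => (lam.withDensityᵥ g).integral f B = ∫ x, B (f x) (g x) ∂lam)
    ?_ ?_ ?_ ?_ hφ
  · intro c s hs hfin
    have : IsFiniteMeasure ((lam.withDensityᵥ g).variation.restrict s) :=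
      ⟨by simpa using hfin⟩
    rw [VectorMeasure.integral_indicator_const _ hs, withDensityᵥ_apply hg hs,
      ← (B c).integral_comp_comm hg.integrableOn, ← integral_indicator hs]
    exact integral_congr_ae (Eventually.of_forall fun x => by
      by_cases hx : x ∈ s <;> simp [hx])
  · intro f₁ f₂ _ h1 h2 e1 e2
    rw [VectorMeasure.integral_add h1 h2, e1, e2, ← integral_add (hint _ h1) (hint _ h2)]
    simp
  · refine isClosed_eq VectorMeasure.continuous_integral ?_
    refine LipschitzWith.continuous (K := ‖B‖₊) fun f₁ f₂ => ?_
    have i1 := hint _ (L1.integrable_coeFn f₁)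
    have i2 := hint _ (L1.integrable_coeFn f₂)
    rw [edist_eq_enorm_sub, ← integral_sub i1 i2]
    refine (enorm_integral_le_lintegral_enorm _).trans ?_
    rw [L1.edist_def]
    have hm : AEStronglyMeasurable (fun x => f₁ x - f₂ x) (lam.withDensityᵥ g).variation :=
      (L1.integrable_coeFn f₁).1.sub (L1.integrable_coeFn f₂).1
    simp only [edist_eq_enorm_sub]
    rw [hlint _ hm, ← enorm_eq_nnnorm, ← lintegral_const_mul' _ _ (by simp)]
    refine lintegral_mono fun x => ?_
    rw [← sub_apply, ← map_sub]
    refine ((B _).le_opENorm (g x)).trans ?_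
    rw [mul_comm ‖g x‖ₑ, ← mul_assoc]
    gcongr
    exact B.le_opENorm _
  · intro f₁ f₂ h _ e
    rw [← VectorMeasure.integral_congr_ae h, e]
    exact integral_congr_ae (hae _ _ h)

end WithDensity

/-- An `ℝ²`-valued measure has a density with respect to its total variation. -/
lemma PlaneMeasure.exists_density (μ : PlaneMeasure) :
    ∃ g : Plane → Plane, Integrable g μ.variation ∧ μ = μ.variation.withDensityᵥ g := by
  let c : Fin 2 → SignedMeasure Plane := fun i =>
    μ.mapRange (EuclideanSpace.proj (𝕜 := ℝ) i : Plane →L[ℝ] ℝ).toLinearMap.toAddMonoidHom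
      (EuclideanSpace.proj (𝕜 := ℝ) i : Plane →L[ℝ] ℝ).continuous
  have hc : ∀ i s, c i s = μ s i := fun i s => rfl
  -- Each component is absolutely continuous with respect to the variation, so the scalar
  -- Radon–Nikodym theorem gives the density one coordinate at a time.
  have hac : ∀ i, c i ≪ᵥ μ.variation.toENNRealVectorMeasure := by
    intro i
    refine VectorMeasure.AbsolutelyContinuous.mk fun s hs h => ?_
    rw [Measure.toENNRealVectorMeasure_apply_measurable hs] at h
    rw [hc, (VectorMeasure.variation_apply_eq_zero hs).1 h s subset_rfl hs]
    simp
  have hd := fun i => SignedMeasure.withDensityᵥ_rnDeriv_eq (c i) μ.variation (hac i)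
  have hi := fun i => SignedMeasure.integrable_rnDeriv (c i) μ.variation
  let g : Plane → Plane := fun x => ∑ i, (c i).rnDeriv μ.variation x • EuclideanSpace.single i 1
  have hg : Integrable g μ.variation :=
    integrable_finsetSum _ fun i _ => (hi i).smul_const _
  refine ⟨g, hg, VectorMeasure.ext fun s hs => ?_⟩
  rw [withDensityᵥ_apply hg hs]
  ext j
  have := (EuclideanSpace.proj (𝕜 := ℝ) j : Plane →L[ℝ] ℝ).integral_comp_comm
    (hg.integrableOn (s := s))
  refine Eq.trans ?_ this
  rw [← hc, ← hd j, withDensityᵥ_apply (hi j) hs]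
  refine integral_congr_ae (Eventually.of_forall fun x => ?_)
  fin_cases j <;> simp [g]

lemma integrable_variation_of_contDiff (μ : PlaneMeasure) {φ : Plane → ℝ} (hφ : ContDiff ℝ ∞ φ)
    (hc : HasCompactSupport φ) : Integrable φ μ.variation :=
  hφ.continuous.integrable_of_hasCompactSupport hc

/-- An `ℝ²`-valued measure is determined by its integrals of test functions. -/
lemma PlaneMeasure.ext_of_integral_eq {μ ν : PlaneMeasure}
    (h : ∀ φ : Plane → ℝ, ContDiff ℝ ∞ φ → HasCompactSupport φ →
      μ.integral φ (ContinuousLinearMap.lsmul ℝ ℝ) = ν.integral φ (ContinuousLinearMap.lsmul ℝ ℝ)) :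
    μ = ν := by
  rw [← sub_eq_zero]
  obtain ⟨g, hg, he⟩ := PlaneMeasure.exists_density (μ - ν)
  have h0 : ∀ᵐ x ∂(μ - ν).variation, g x = 0 := by
    refine ae_eq_zero_of_integral_contDiff_smul_eq_zero hg.locallyIntegrable fun φ hφ hc => ?_
    have h1 : (μ - ν).integral φ (ContinuousLinearMap.lsmul ℝ ℝ) = 0 := by
      rw [VectorMeasure.integral_sub_vectorMeasure (integrable_variation_of_contDiff μ hφ hc)
        (integrable_variation_of_contDiff ν hφ hc), h φ hφ hc, sub_self]
    have hi : Integrable φ ((μ - ν).variation.withDensityᵥ g).variation := by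
      rw [← he]; exact integrable_variation_of_contDiff _ hφ hc
    have h2 := integral_withDensityᵥ hg (ContinuousLinearMap.lsmul ℝ ℝ) hi
    rw [← he, h1] at h2
    exact h2.symm
  rw [he]
  exact (WithDensityᵥEq.congr_ae (g := 0) h0).trans withDensityᵥ_zero

/-! ### The perpendicular gradient in terms of densities -/

/-- The pairing `⟨u, v⟩ ↦ u₂ v₁ - u₁ v₂`. -/
def cross (u v : Plane) : ℝ := u 1 * v 0 - u 0 * v 1

/-- Lagrange's identity: the difference of the squares of the two sides is the square of the inner
product of `u` and `v`. -/
lemma abs_cross_le (u v : Plane) : |cross u v| ≤ ‖u‖ * ‖v‖ := by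
  refine abs_le_of_sq_le_sq ?_ (by positivity)
  rw [mul_pow, EuclideanSpace.real_norm_sq_eq, EuclideanSpace.real_norm_sq_eq]
  simp only [Fin.sum_univ_two, cross]
  nlinarith [sq_nonneg (u 0 * v 0 + u 1 * v 1)]

lemma norm_rotate (v : Plane) : ‖(!₂[v 1, -v 0] : Plane)‖ = ‖v‖ := by
  simp [EuclideanSpace.norm_eq, Fin.sum_univ_two, add_comm]

lemma integrable_cross {lam : Measure Plane} {g : Plane → Plane} (hg : Integrable g lam)
    {Φ : Plane → Plane} (hΦ : Continuous Φ) (hc : HasCompactSupport Φ) :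
    Integrable (fun x => cross (Φ x) (g x)) lam := by
  obtain ⟨C, hC⟩ := hc.exists_bound_of_continuous hΦ
  have h0 : AEStronglyMeasurable (fun x => cross (Φ x) (g x)) lam := by
    have : Continuous fun p : Plane × Plane => cross p.1 p.2 := by unfold cross; fun_prop
    exact this.comp_aestronglyMeasurable (f := fun x => (Φ x, g x))
      (hΦ.aestronglyMeasurable.prodMk hg.aestronglyMeasurable)
  refine (hg.norm.const_mul C).mono' h0 (Eventually.of_forall fun x => ?_)
  exact (abs_cross_le _ _).trans (mul_le_mul_of_nonneg_right (hC x) (norm_nonneg _))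

lemma abs_integral_cross_le {lam : Measure Plane} {g : Plane → Plane} (hg : Integrable g lam)
    {Φ : Plane → Plane} (hΦ : ∀ x, ‖Φ x‖ ≤ 1) :
    |∫ x, cross (Φ x) (g x) ∂lam| ≤ ∫ x, ‖g x‖ ∂lam := by
  rw [← Real.norm_eq_abs]
  refine norm_integral_le_of_norm_le hg.norm (Eventually.of_forall fun x => ?_)
  exact (abs_cross_le _ _).trans (mul_le_of_le_one_left (norm_nonneg _) (hΦ x))

lemma integral_withDensityᵥ_smul_apply {lam : Measure Plane} {g : Plane → Plane}
    (hg : Integrable g lam) {φ : Plane → ℝ} (hφ : ContDiff ℝ ∞ φ) (hc : HasCompactSupport φ)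
    (i : Fin 2) :
    (lam.withDensityᵥ g).integral φ (ContinuousLinearMap.lsmul ℝ ℝ) i
      = ∫ x, φ x * g x i ∂lam := by
  rw [integral_withDensityᵥ hg _ (integrable_variation_of_contDiff _ hφ hc)]
  obtain ⟨C, hC⟩ := hc.exists_bound_of_continuous hφ.continuous
  have hi : Integrable (fun x => φ x • g x) lam :=
    hg.bdd_smul C hφ.continuous.aestronglyMeasurable (Eventually.of_forall hC)
  exact ((EuclideanSpace.proj (𝕜 := ℝ) i : Plane →L[ℝ] ℝ).integral_comp_comm hi).symm

lemma contDiff_apply_plane {Φ : Plane → Plane} (h : ContDiff ℝ ∞ Φ) (i : Fin 2) :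
    ContDiff ℝ ∞ fun x => Φ x i :=
  (EuclideanSpace.proj (𝕜 := ℝ) i : Plane →L[ℝ] ℝ).contDiff.comp h

lemma hasCompactSupport_apply_plane {Φ : Plane → Plane} (h : HasCompactSupport Φ) (i : Fin 2) :
    HasCompactSupport fun x => Φ x i :=
  h.comp_left (g := fun v : Plane => v i) rfl

lemma divergence_eq_partialD {Φ : Plane → Plane} (h : ContDiff ℝ ∞ Φ) (x : Plane) :
    divergence Φ x = partialD 0 (fun y => Φ y 0) x + partialD 1 (fun y => Φ y 1) x := by
  have hd : ∀ i : Fin 2, fderiv ℝ (fun y => Φ y i) x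
      = (EuclideanSpace.proj (𝕜 := ℝ) i : Plane →L[ℝ] ℝ).comp (fderiv ℝ Φ x) := fun i =>
    ((EuclideanSpace.proj (𝕜 := ℝ) i : Plane →L[ℝ] ℝ).hasFDerivAt.comp x
      (h.differentiable (by simp) x).hasFDerivAt).fderiv
  simp [divergence, partialD, hd]

lemma fderiv_apply_eq_partialD (φ : Plane → ℝ) (x v : Plane) :
    fderiv ℝ φ x v = v 0 * partialD 0 φ x + v 1 * partialD 1 φ x := by
  have hv : v = ∑ i : Fin 2, v i • EuclideanSpace.single i (1 : ℝ) := by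
    ext j; fin_cases j <;> simp
  conv_lhs => rw [hv]
  simp [partialD]

lemma continuous_partialD {φ : Plane → ℝ} (h : ContDiff ℝ ∞ φ) (i : Fin 2) :
    Continuous (partialD i φ) := by
  have := h.continuous_fderiv (by simp)
  unfold partialD
  fun_prop

lemma contDiff_partialD {φ : Plane → ℝ} (h : ContDiff ℝ ∞ φ) (i : Fin 2) :
    ContDiff ℝ ∞ (partialD i φ) :=
  (h.fderiv_right (m := ∞) (by simp)).clm_apply contDiff_const

lemma hasCompactSupport_partialD {φ : Plane → ℝ} (h : HasCompactSupport φ) (i : Fin 2) :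
    HasCompactSupport (partialD i φ) :=
  h.fderiv_apply (𝕜 := ℝ) _

lemma integrable_mul_partialD (f : Lp ℝ 2 (volume : Measure Plane)) {φ : Plane → ℝ}
    (h : ContDiff ℝ ∞ φ) (hc : HasCompactSupport φ) (i : Fin 2) :
    Integrable (fun x => f x * partialD i φ x) := by
  simpa [mul_comm] using (locallyIntegrable_Lp_two f).integrable_smul_right_of_hasCompactSupport
    (continuous_partialD h i) (hasCompactSupport_partialD hc i)

lemma integrable_mul_apply {lam : Measure Plane} {g : Plane → Plane} (hg : Integrable g lam)
    {φ : Plane → ℝ} (hφ : Continuous φ) (hc : HasCompactSupport φ) (i : Fin 2) :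
    Integrable (fun x => φ x * g x i) lam := by
  obtain ⟨C, hC⟩ := hc.exists_bound_of_continuous hφ
  have hi : Integrable (fun x => g x i) lam :=
    (EuclideanSpace.proj (𝕜 := ℝ) i : Plane →L[ℝ] ℝ).integrable_comp hg
  exact hi.bdd_mul (c := C) hφ.aestronglyMeasurable (Eventually.of_forall hC)

/-- `∇^⊥ f = g λ` means that `∫ f div Φ = ∫ (Φ₂ g₁ - Φ₁ g₂) dλ` for all test fields `Φ`. -/
lemma isPerpGradient_withDensityᵥ_iff (f : Lp ℝ 2 (volume : Measure Plane))
    {lam : Measure Plane} {g : Plane → Plane} (hg : Integrable g lam) :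
    IsPerpGradient f (lam.withDensityᵥ g) ↔
      ∀ Φ : Plane → Plane, ContDiff ℝ ∞ Φ → HasCompactSupport Φ →
        ∫ x, f x * divergence Φ x = ∫ x, cross (Φ x) (g x) ∂lam := by
  constructor
  · intro h Φ hΦ hc
    -- The component `Φ 0` is tested against the second coordinate of the measure and `Φ 1` against
    -- the first; their combination is `cross`.
    have h0 := congrArg (fun v : Plane => v 1)
      (h _ (contDiff_apply_plane hΦ 0) (hasCompactSupport_apply_plane hc 0))
    have h1 := congrArg (fun v : Plane => v 0)
      (h _ (contDiff_apply_plane hΦ 1) (hasCompactSupport_apply_plane hc 1))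
    simp only [integral_withDensityᵥ_smul_apply hg (contDiff_apply_plane hΦ _)
      (hasCompactSupport_apply_plane hc _)] at h0 h1
    simp only [Matrix.cons_val_zero, Matrix.cons_val_one] at h0 h1
    simp only [cross]
    rw [integral_sub
      (integrable_mul_apply hg (contDiff_apply_plane hΦ 1).continuous
        (hasCompactSupport_apply_plane hc 1) 0)
      (integrable_mul_apply hg (contDiff_apply_plane hΦ 0).continuous
        (hasCompactSupport_apply_plane hc 0) 1), h0, h1, sub_neg_eq_add, add_comm, ← integral_add
      (integrable_mul_partialD f (contDiff_apply_plane hΦ 0) (hasCompactSupport_apply_plane hc 0) 0)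
      (integrable_mul_partialD f (contDiff_apply_plane hΦ 1) (hasCompactSupport_apply_plane hc 1) 1)]
    refine integral_congr_ae (Eventually.of_forall fun x => ?_)
    simp only [divergence_eq_partialD hΦ]
    ring
  · intro h φ hφ hc
    -- The scalar identities come from the test fields `φ e_i`, whose divergence is `∂_i φ`.
    have key : ∀ i : Fin 2, ∫ x, f x * partialD i φ x
        = ∫ x, cross (φ x • EuclideanSpace.single i 1) (g x) ∂lam := by
      intro i
      have hΦ : ContDiff ℝ ∞ fun x => φ x • (EuclideanSpace.single i (1 : ℝ) : Plane) :=
        hφ.smul contDiff_const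
      rw [← h _ hΦ hc.smul_right]
      refine integral_congr_ae (Eventually.of_forall fun x => ?_)
      simp only [divergence_eq_partialD hΦ]
      fin_cases i <;> simp [partialD]
    rw [key, key]
    ext i
    rw [integral_withDensityᵥ_smul_apply hg hφ hc]
    fin_cases i <;> simp [cross, ← integral_neg]

lemma measureDiv_eq_neg_integral_fderiv {μ : PlaneMeasure} {g : Plane → Plane}
    (hg : Integrable g μ.variation) (he : μ = μ.variation.withDensityᵥ g) {φ : Plane → ℝ}
    (hφ : ContDiff ℝ ∞ φ) (hc : HasCompactSupport φ) :
    measureDiv μ φ = -∫ x, fderiv ℝ φ x (g x) ∂μ.variation := by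
  have hi := integrable_gradient μ hφ hc
  rw [he] at hi
  conv_lhs => rw [he]
  rw [measureDiv, integral_withDensityᵥ hg _ hi]
  refine congrArg Neg.neg (integral_congr_ae (Eventually.of_forall fun x => ?_))
  exact InnerProductSpace.toDual_symm_apply (𝕜 := ℝ) (E := Plane) (y := fderiv ℝ φ x)

/-- The measure `∇^⊥ f` is divergence-free. -/
lemma IsPerpGradient.mem_divFreeMeasure {f : Lp ℝ 2 (volume : Measure Plane)}
    {μ : PlaneMeasure} (h : IsPerpGradient f μ) : μ ∈ DivFreeMeasure := by
  intro φ hφ hc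
  obtain ⟨g, hg, he⟩ := μ.exists_density
  have hint : ∀ i : Fin 2, ∫ x, partialD i φ x * g x i ∂μ.variation
      = μ.integral (partialD i φ) (ContinuousLinearMap.lsmul ℝ ℝ) i := by
    intro i
    conv_rhs => rw [he]
    exact (integral_withDensityᵥ_smul_apply hg (contDiff_partialD hφ i)
      (hasCompactSupport_partialD hc i) i).symm
  -- Testing with the partial derivatives of `φ` gives `∫ ∇φ · dμ = ∫ f ∂₂∂₁φ - ∫ f ∂₁∂₂φ`.
  have hsymm : ∀ x, partialD 1 (partialD 0 φ) x = partialD 0 (partialD 1 φ) x := by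
    intro x
    have hs : IsSymmSndFDerivAt ℝ φ x :=
      hφ.contDiffAt.isSymmSndFDerivAt (by
        simpa using WithTop.coe_le_coe.2 (le_top : (2 : ℕ∞) ≤ ⊤))
    have hd : DifferentiableAt ℝ (fderiv ℝ φ) x :=
      (hφ.fderiv_right (m := ∞) (by simp)).differentiable (by simp) x
    have h2 : ∀ i j : Fin 2, partialD i (partialD j φ) x
        = fderiv ℝ (fderiv ℝ φ) x (EuclideanSpace.single i 1) (EuclideanSpace.single j 1) := by
      intro i j
      have := (hd.hasFDerivAt.clm_apply
        (hasFDerivAt_const (EuclideanSpace.single j (1 : ℝ) : Plane) x)).fderiv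
      unfold partialD
      rw [this]
      simp
    rw [h2, h2, hs.eq]
  rw [measureDiv_eq_neg_integral_fderiv hg he hφ hc]
  simp only [fderiv_apply_eq_partialD, mul_comm (g _ _)]
  rw [integral_add
      (integrable_mul_apply hg (continuous_partialD hφ 0) (hasCompactSupport_partialD hc 0) 0)
      (integrable_mul_apply hg (continuous_partialD hφ 1) (hasCompactSupport_partialD hc 1) 1),
    hint, hint, h _ (contDiff_partialD hφ 0) (hasCompactSupport_partialD hc 0),
    h _ (contDiff_partialD hφ 1) (hasCompactSupport_partialD hc 1)]
  simp [hsymm]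

/-- `V(f) ≤ |μ|(ℝ²)` if `∇^⊥ f = μ`. -/
lemma IsPerpGradient.planeVariation_le {f : Lp ℝ 2 (volume : Measure Plane)}
    {μ : PlaneMeasure} (h : IsPerpGradient f μ) :
    planeVariation f ≤ μ.variation univ := by
  obtain ⟨g, hg, he⟩ := μ.exists_density
  rw [he] at h
  have hv : μ.variation univ = ∫⁻ x, ‖g x‖ₑ ∂μ.variation := by
    conv_lhs => rw [he]
    rw [Measure.variation_withDensityᵥ hg, withDensity_apply _ MeasurableSet.univ,
      Measure.restrict_univ]
  rw [hv, ← ofReal_integral_norm_eq_lintegral_enorm hg]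
  refine iSup₂_le fun Φ hΦ => ENNReal.ofReal_le_ofReal ?_
  rw [(isPerpGradient_withDensityᵥ_iff f hg).1 h Φ hΦ.smooth hΦ.compact]
  exact (le_abs_self _).trans (abs_integral_cross_le hg hΦ.bound)

/-! ### Functionals that factor through a linear map -/

/-- A linear functional `A` with `|A m| ≤ C ‖D m‖` factors through `D` by a continuous functional of
norm at most `C`. -/
lemma exists_strongDual_comp_eq {M E : Type*} [AddCommGroup M] [Module ℝ M]
    [NormedAddCommGroup E] [NormedSpace ℝ E] (D : M →ₗ[ℝ] E) (A : M →ₗ[ℝ] ℝ) {C : ℝ}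
    (hC : 0 ≤ C) (h : ∀ m, |A m| ≤ C * ‖D m‖) :
    ∃ G : StrongDual ℝ E, ‖G‖ ≤ C ∧ ∀ m, G (D m) = A m := by
  obtain ⟨s, hs⟩ := D.rangeRestrict.exists_rightInverse_of_surjective
    (LinearMap.range_rangeRestrict D)
  have hs' : ∀ y, D (s y) = y := fun y => congrArg Subtype.val (LinearMap.congr_fun hs y)
  let G₀ : StrongDual ℝ (LinearMap.range D) := (A.comp s).mkContinuous C fun y => by
    have := h (s y)
    rwa [hs'] at this
  obtain ⟨G, hG, hn⟩ := exists_extension_norm_eq (LinearMap.range D) G₀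
  refine ⟨G, hn.trans_le (LinearMap.mkContinuous_norm_le _ hC _), fun m => ?_⟩
  have e1 := hG (D.rangeRestrict m)
  -- The bound makes `A` vanish on the kernel of `D`, so the choice of the section `s` does not
  -- matter.
  have e2 : A (s (D.rangeRestrict m) - m) = 0 := by
    have := h (s (D.rangeRestrict m) - m)
    rw [map_sub D, hs'] at this
    simpa using this
  rw [map_sub, sub_eq_zero] at e2
  rw [← e2]
  exact e1

/-! ### The Riesz representation theorem for vector-valued functions -/

open scoped BoundedContinuousFunction NNReal CompactlySupported

section Riesz

variable {X E : Type*} [TopologicalSpace X] [NormedAddCommGroup E] [NormedSpace ℝ E]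

/-- The absolute value of a functional on bounded continuous vector-valued functions, as a function
on `C_c(X, ℝ≥0)`. -/
def dualAbs (G : StrongDual ℝ (X →ᵇ E)) (u : C_c(X, ℝ≥0)) : ℝ :=
  ⨆ Φ : {Φ : X →ᵇ E // ∀ x, ‖Φ x‖ ≤ u x}, G Φ

instance (u : C_c(X, ℝ≥0)) : Nonempty {Φ : X →ᵇ E // ∀ x, ‖Φ x‖ ≤ u x} := ⟨⟨0, by simp⟩⟩

lemma dual_apply_le_of_bound (G : StrongDual ℝ (X →ᵇ E)) {Φ : X →ᵇ E} {C : ℝ} (hC : 0 ≤ C)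
    (h : ∀ x, ‖Φ x‖ ≤ C) : G Φ ≤ ‖G‖ * C :=
  (le_abs_self _).trans ((G.le_opNorm Φ).trans
    (mul_le_mul_of_nonneg_left ((BoundedContinuousFunction.norm_le hC).2 h) (norm_nonneg _)))

lemma bddAbove_dualAbs (G : StrongDual ℝ (X →ᵇ E)) (u : C_c(X, ℝ≥0)) :
    BddAbove (range fun Φ : {Φ : X →ᵇ E // ∀ x, ‖Φ x‖ ≤ u x} => G Φ) := by
  have hc : HasCompactSupport fun x => (u x : ℝ) :=
    u.hasCompactSupport.comp_left (g := ((↑) : ℝ≥0 → ℝ)) rfl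
  obtain ⟨C, hC⟩ := hc.exists_bound_of_continuous (by fun_prop)
  refine ⟨‖G‖ * max C 0, ?_⟩
  rintro _ ⟨Φ, rfl⟩
  refine dual_apply_le_of_bound G (le_max_right _ _) fun x => ?_
  exact (Φ.2 x).trans (((le_abs_self _).trans (hC x)).trans (le_max_left _ _))

lemma apply_le_dualAbs (G : StrongDual ℝ (X →ᵇ E)) {u : C_c(X, ℝ≥0)} {Φ : X →ᵇ E}
    (h : ∀ x, ‖Φ x‖ ≤ u x) : G Φ ≤ dualAbs G u :=
  le_ciSup (bddAbove_dualAbs G u) ⟨Φ, h⟩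

lemma dualAbs_le (G : StrongDual ℝ (X →ᵇ E)) {u : C_c(X, ℝ≥0)} {C : ℝ}
    (h : ∀ Φ : X →ᵇ E, (∀ x, ‖Φ x‖ ≤ u x) → G Φ ≤ C) : dualAbs G u ≤ C :=
  ciSup_le fun Φ => h Φ.1 Φ.2

lemma dualAbs_nonneg (G : StrongDual ℝ (X →ᵇ E)) (u : C_c(X, ℝ≥0)) : 0 ≤ dualAbs G u := by
  simpa using apply_le_dualAbs G (u := u) (Φ := 0) (by simp)

lemma dualAbs_le_norm (G : StrongDual ℝ (X →ᵇ E)) {u : C_c(X, ℝ≥0)} (h : ∀ x, u x ≤ 1) :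
    dualAbs G u ≤ ‖G‖ :=
  dualAbs_le G fun Φ hΦ => by
    simpa using dual_apply_le_of_bound G zero_le_one fun x => (hΦ x).trans (mod_cast h x)

/-- A field dominated by `u + v` splits, up to a small error, into multiples of itself dominated by
`u` and by `v`. Conversely, sums of competitors for `u` and `v` compete for `u + v`. -/
lemma dualAbs_add (G : StrongDual ℝ (X →ᵇ E)) (u v : C_c(X, ℝ≥0)) :
    dualAbs G (u + v) = dualAbs G u + dualAbs G v := by
  apply le_antisymm
  · refine dualAbs_le G fun Φ hΦ => le_of_forall_pos_le_add fun δ hδ => ?_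
    -- Adding `ε` to the denominator `u + v` keeps the weights continuous where `u + v = 0`. The
    -- remainder `ε Φ / (u + v + ε)` has norm at most `ε`, hence costs at most `‖G‖ ε ≤ δ`.
    set ε : ℝ := δ / (‖G‖ + 1) with hε
    have hεpos : 0 < ε := by positivity
    have hεδ : ‖G‖ * ε ≤ δ := by
      rw [hε, mul_div_assoc', div_le_iff₀ (by positivity)]
      nlinarith [norm_nonneg G]
    have hcont : ∀ w : C_c(X, ℝ≥0), Continuous fun x =>
        ((w x : ℝ) / (u x + v x + ε)) • Φ x := by
      intro w
      refine Continuous.smul (Continuous.div (by fun_prop) (by fun_prop) fun x => ?_) (by fun_prop)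
      positivity
    have hbound : ∀ (w : C_c(X, ℝ≥0)) (x : X),
        ‖((w x : ℝ) / (u x + v x + ε)) • Φ x‖ ≤ w x := by
      intro w x
      have h1 := hΦ x
      simp only [CompactlySupportedContinuousMap.coe_add, Pi.add_apply, NNReal.coe_add] at h1
      rw [norm_smul, Real.norm_of_nonneg (by positivity), div_mul_eq_mul_div,
        div_le_iff₀ (by positivity)]
      gcongr
      linarith
    have hb : ∀ w : C_c(X, ℝ≥0), w = u ∨ w = v → ∀ x,
        ‖((w x : ℝ) / (u x + v x + ε)) • Φ x‖ ≤ ‖Φ‖ := by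
      intro w hw x
      refine le_trans ?_ (Φ.norm_coe_le_norm x)
      rw [norm_smul, Real.norm_of_nonneg (by positivity)]
      refine mul_le_of_le_one_left (norm_nonneg _) ((div_le_one (by positivity)).2 ?_)
      have h1 := (u x).coe_nonneg
      have h2 := (v x).coe_nonneg
      rcases hw with rfl | rfl <;> linarith
    let Φ₁ : X →ᵇ E := .ofNormedAddCommGroup _ (hcont u) ‖Φ‖ (hb u (.inl rfl))
    let Φ₂ : X →ᵇ E := .ofNormedAddCommGroup _ (hcont v) ‖Φ‖ (hb v (.inr rfl))
    have h1 : G Φ₁ ≤ dualAbs G u := apply_le_dualAbs G (hbound u)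
    have h2 : G Φ₂ ≤ dualAbs G v := apply_le_dualAbs G (hbound v)
    have h3 : G (Φ - Φ₁ - Φ₂) ≤ ‖G‖ * ε := by
      refine dual_apply_le_of_bound G hεpos.le fun x => ?_
      have hx := hΦ x
      simp only [CompactlySupportedContinuousMap.coe_add, Pi.add_apply, NNReal.coe_add] at hx
      have e : (Φ - Φ₁ - Φ₂) x = (ε / (u x + v x + ε)) • Φ x := by
        have hne : (u x + v x + ε : ℝ) ≠ 0 := by positivity
        have : (ε / (u x + v x + ε) : ℝ)
            = 1 - (u x : ℝ) / (u x + v x + ε) - (v x : ℝ) / (u x + v x + ε) := by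
          field_simp
          ring
        rw [this, sub_smul, sub_smul, one_smul]
        rfl
      rw [e, norm_smul, Real.norm_of_nonneg (by positivity), div_mul_eq_mul_div,
        div_le_iff₀ (by positivity)]
      gcongr
      linarith
    have h4 : G Φ = G Φ₁ + G Φ₂ + G (Φ - Φ₁ - Φ₂) := by
      rw [map_sub, map_sub]; ring
    linarith
  · rw [← le_sub_iff_add_le]
    refine dualAbs_le G fun Φ hΦ => ?_
    rw [le_sub_comm]
    refine dualAbs_le G fun Ψ hΨ => ?_
    rw [le_sub_iff_add_le, ← map_add]
    refine apply_le_dualAbs G fun x => ?_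
    simp only [BoundedContinuousFunction.coe_add, Pi.add_apply,
      CompactlySupportedContinuousMap.coe_add, NNReal.coe_add]
    linarith [norm_add_le (Ψ x) (Φ x), hΦ x, hΨ x]

/-- Scaling a competitor for `u` by `c` gives one for `c • u`; applied with `c⁻¹`, this also yields
the reverse inequality when `c ≠ 0`. -/
lemma mul_dualAbs_le (G : StrongDual ℝ (X →ᵇ E)) (c : ℝ≥0) (u : C_c(X, ℝ≥0)) :
    c * dualAbs G u ≤ dualAbs G (c • u) := by
  rcases eq_or_ne c 0 with rfl | hc
  · simpa using dualAbs_nonneg G _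
  have hc' : (0 : ℝ) < c := by positivity
  rw [← le_div_iff₀' hc']
  refine dualAbs_le G fun Φ hΦ => ?_
  rw [le_div_iff₀' hc', ← smul_eq_mul, ← map_smul]
  refine apply_le_dualAbs G fun x => ?_
  simpa [norm_smul] using mul_le_mul_of_nonneg_left (hΦ x) hc'.le

lemma dualAbs_smul (G : StrongDual ℝ (X →ᵇ E)) (c : ℝ≥0) (u : C_c(X, ℝ≥0)) :
    dualAbs G (c • u) = c * dualAbs G u := by
  refine le_antisymm ?_ (mul_dualAbs_le G c u)
  rcases eq_or_ne c 0 with rfl | hc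
  · refine dualAbs_le G fun Φ hΦ => ?_
    simpa using dual_apply_le_of_bound G le_rfl fun x => by simpa using hΦ x
  have h := mul_dualAbs_le G c⁻¹ (c • u)
  rw [smul_smul, inv_mul_cancel₀ hc, one_smul, NNReal.coe_inv,
    inv_mul_le_iff₀ (by positivity)] at h
  exact h

/-- The absolute value of a functional as a positive functional on `C_c(X, ℝ≥0)`. -/
def dualAbsLinear (G : StrongDual ℝ (X →ᵇ E)) : C_c(X, ℝ≥0) →ₗ[ℝ≥0] ℝ≥0 where
  toFun u := ⟨dualAbs G u, dualAbs_nonneg G u⟩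
  map_add' u v := NNReal.eq (dualAbs_add G u v)
  map_smul' c u := NNReal.eq (dualAbs_smul G c u)

end Riesz

/-- **Riesz representation theorem** for bounded functionals on vector-valued continuous functions:
on continuous functions of compact support they are given by an integrable density with respect to
a finite measure, of total mass at most the norm of the functional. -/
theorem exists_measure_density_of_strongDual {X E : Type*} [TopologicalSpace X] [T2Space X]
    [LocallyCompactSpace X] [MeasurableSpace X] [BorelSpace X]
    [NormedAddCommGroup E] [InnerProductSpace ℝ E] [CompleteSpace E]
    (G : StrongDual ℝ (X →ᵇ E)) :
    ∃ (lam : Measure X) (h : X → E), Integrable h lam ∧ ∫ x, ‖h x‖ ∂lam ≤ ‖G‖ ∧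
      ∀ Φ : X →ᵇ E, HasCompactSupport Φ → G Φ = ∫ x, inner ℝ (Φ x) (h x) ∂lam := by
  set lam := NNRealRMK.rieszMeasure (dualAbsLinear G) with hlam
  -- Inner regularity reduces the total mass to compact sets, each dominated by a cutoff function
  -- with values in `[0, 1]`.
  have huniv : lam univ ≤ ENNReal.ofReal ‖G‖ := by
    rw [isOpen_univ.measure_eq_iSup_isCompact]
    refine iSup₂_le fun K _ => iSup_le fun hK => ?_
    obtain ⟨f, hf1, -, hfc, hf⟩ := exists_continuous_one_zero_of_isCompact hK isClosed_empty
      (disjoint_empty K)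
    let u : C_c(X, ℝ≥0) := ⟨⟨fun x => (f x).toNNReal, by fun_prop⟩,
      hfc.comp_left Real.toNNReal_zero⟩
    calc lam K = ∫⁻ _ in K, 1 ∂lam := by simp
      _ ≤ ∫⁻ x in K, u x ∂lam := by
        refine setLIntegral_mono' hK.measurableSet fun x hx => ?_
        have : u x = 1 := by simp [u, hf1 hx]
        simp [this]
      _ ≤ ∫⁻ x, u x ∂lam := setLIntegral_le_lintegral _ _
      _ = (dualAbsLinear G u : ℝ≥0∞) := NNRealRMK.lintegral_rieszMeasure _ u
      _ ≤ ENNReal.ofReal ‖G‖ := by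
        rw [← ENNReal.ofReal_coe_nnreal]
        refine ENNReal.ofReal_le_ofReal (dualAbs_le_norm G fun x => ?_)
        exact Real.toNNReal_le_one.2 (hf x).2
  have hfin : IsFiniteMeasure lam := ⟨huniv.trans_lt ENNReal.ofReal_lt_top⟩
  have hreal : lam.real univ ≤ ‖G‖ :=
    ENNReal.toReal_le_of_le_ofReal (norm_nonneg G) huniv
  -- Both `Φ` and `-Φ` compete in the supremum that defines the absolute value at `u = ‖Φ‖`.
  have hbound : ∀ Φ : X →ᵇ E, HasCompactSupport Φ → |G Φ| ≤ ∫ x, ‖Φ x‖ ∂lam := by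
    intro Φ hΦ
    let u : C_c(X, ℝ≥0) := ⟨⟨fun x => ‖Φ x‖₊, by fun_prop⟩, hΦ.comp_left nnnorm_zero⟩
    have e : ∫ x, ‖Φ x‖ ∂lam = dualAbs G u :=
      NNRealRMK.integral_rieszMeasure (dualAbsLinear G) u
    rw [e]
    refine abs_le'.2 ⟨apply_le_dualAbs G fun x => le_rfl, ?_⟩
    rw [← map_neg]
    exact apply_le_dualAbs G fun x => by simp [u]
  let M : Submodule ℝ (X →ᵇ E) :=
    { carrier := {Φ | HasCompactSupport Φ}
      add_mem' := fun h₁ h₂ => HasCompactSupport.add h₁ h₂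
      zero_mem' := HasCompactSupport.zero
      smul_mem' := fun c Φ h => HasCompactSupport.smul_left (f := fun _ => c) h }
  have hL : ∀ Φ : M, MemLp Φ.1 2 lam := fun Φ =>
    Φ.1.continuous.memLp_of_hasCompactSupport Φ.2
  let D : M →ₗ[ℝ] Lp E 2 lam :=
    { toFun := fun Φ => (hL Φ).toLp
      map_add' := fun Φ Ψ => MemLp.toLp_add (hL Φ) (hL Ψ)
      map_smul' := fun c Φ => MemLp.toLp_const_smul c (hL Φ) }
  -- This is the Cauchy–Schwarz constant between the `L¹` and `L²` norms. It is used twice, for the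
  -- functional and for its density, so the density has `L¹` norm at most `s² = lam(X) ≤ ‖G‖` with
  -- no loss.
  set s : ℝ := Real.sqrt (lam.real univ) with hs
  have hcs : ∀ f : Lp E 2 lam, ∫ x, ‖f x‖ ∂lam ≤ s * ‖f‖ := by
    intro f
    have h1 := eLpNorm_le_eLpNorm_mul_rpow_measure_univ (μ := lam) (p := 1) (q := 2) (by norm_num)
      (Lp.aestronglyMeasurable f)
    have h2 := ENNReal.toReal_mono (ENNReal.mul_ne_top (Lp.memLp f).eLpNorm_ne_top
      (ENNReal.rpow_ne_top_of_nonneg (by norm_num) (measure_ne_top _ _))) h1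
    rw [ENNReal.toReal_mul, ← ENNReal.toReal_rpow, eLpNorm_one_eq_lintegral_enorm,
      ← integral_norm_eq_lintegral_enorm (Lp.aestronglyMeasurable f), ← Lp.norm_def] at h2
    rw [mul_comm, hs, Real.sqrt_eq_rpow]
    convert h2 using 3
    · rfl
    · rw [ENNReal.toReal_one, ENNReal.toReal_ofNat]
      norm_num
  obtain ⟨H, hHn, hH⟩ := exists_strongDual_comp_eq D (G.toLinearMap.comp M.subtype)
    (Real.sqrt_nonneg (lam.real univ)) (fun Φ => by
      refine (hbound Φ.1 Φ.2).trans (le_trans (le_of_eq ?_) (hcs (D Φ)))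
      refine integral_congr_ae ?_
      filter_upwards [(hL Φ).coeFn_toLp] with x hx
      simp only [D, LinearMap.coe_mk, AddHom.coe_mk, hx])
  set h := (InnerProductSpace.toDual ℝ (Lp E 2 lam)).symm H with hh
  refine ⟨lam, h, (Lp.memLp h).integrable (by norm_num), ?_, fun Φ hΦ => ?_⟩
  · refine (hcs h).trans ?_
    have : ‖h‖ ≤ s := by rw [hh, LinearIsometryEquiv.norm_map]; exact hHn
    calc s * ‖h‖ ≤ s * s := by gcongr
      _ = lam.real univ := Real.mul_self_sqrt measureReal_nonneg
      _ ≤ ‖G‖ := hreal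
  · have e := hH ⟨Φ, hΦ⟩
    rw [← InnerProductSpace.toDual_symm_apply (𝕜 := ℝ), real_inner_comm, L2.inner_def] at e
    rw [show G Φ = _ from e.symm]
    refine integral_congr_ae ?_
    filter_upwards [(hL ⟨Φ, hΦ⟩).coeFn_toLp] with x hx
    simp only [D, LinearMap.coe_mk, AddHom.coe_mk, hx]
    rfl

/-! ### Test fields -/

/-- The space `C_c^∞(ℝ²; ℝ²)`. -/
def testField : Submodule ℝ (Plane → Plane) where
  carrier := {Φ | ContDiff ℝ ∞ Φ ∧ HasCompactSupport Φ}
  add_mem' h₁ h₂ := ⟨h₁.1.add h₂.1, h₁.2.add h₂.2⟩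
  zero_mem' := ⟨contDiff_const, HasCompactSupport.zero⟩
  smul_mem' c _ h := ⟨contDiff_const.smul h.1, h.2.smul_left (f := fun _ => c)⟩

/-- The type of test fields. -/
abbrev TestField : Type := testField

namespace TestField

lemma contDiff (Φ : TestField) : ContDiff ℝ ∞ (Φ : Plane → Plane) := Φ.2.1

lemma hasCompactSupport (Φ : TestField) : HasCompactSupport (Φ : Plane → Plane) := Φ.2.2

lemma divergence_add (Φ Ψ : TestField) (x : Plane) :
    divergence (Φ + Ψ : TestField).1 x = divergence Φ x + divergence Ψ x := by
  have h1 := Φ.contDiff.differentiable (by simp) x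
  have h2 := Ψ.contDiff.differentiable (by simp) x
  simp only [divergence, Submodule.coe_add, fderiv_add h1 h2]
  simp [Finset.sum_add_distrib]

lemma divergence_smul (c : ℝ) (Φ : TestField) (x : Plane) :
    divergence (c • Φ : TestField).1 x = c * divergence Φ x := by
  have h1 := Φ.contDiff.differentiable (by simp) x
  simp only [divergence, Submodule.coe_smul, fderiv_const_smul h1]
  simp [mul_add]

/-- Test fields as bounded continuous functions. -/
def toBCF : TestField →ₗ[ℝ] Plane →ᵇ Plane where
  toFun Φ := .ofNormedAddCommGroup Φ Φ.contDiff.continuous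
    (Φ.hasCompactSupport.exists_bound_of_continuous Φ.contDiff.continuous).choose
    (Φ.hasCompactSupport.exists_bound_of_continuous Φ.contDiff.continuous).choose_spec
  map_add' _ _ := rfl
  map_smul' _ _ := rfl

lemma memLp_divergence (Φ : TestField) : MemLp (divergence Φ) 2 (volume : Measure Plane) :=
  (continuous_divergence Φ.contDiff).memLp_of_hasCompactSupport
    (hasCompactSupport_divergence Φ.hasCompactSupport)

/-- The divergence of test fields, with values in `L²`. -/
def divL2 : TestField →ₗ[ℝ] Lp ℝ 2 (volume : Measure Plane) where
  toFun Φ := Φ.memLp_divergence.toLp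
  map_add' Φ Ψ := by
    rw [← MemLp.toLp_add]
    exact MemLp.toLp_congr _ _ (Eventually.of_forall (divergence_add Φ Ψ))
  map_smul' c Φ := by
    rw [RingHom.id_apply, ← MemLp.toLp_const_smul]
    exact MemLp.toLp_congr _ _ (Eventually.of_forall (divergence_smul c Φ))

lemma inner_divL2 (f : Lp ℝ 2 (volume : Measure Plane)) (Φ : TestField) :
    inner ℝ f (divL2 Φ) = ∫ x, f x * divergence Φ x := by
  rw [L2.inner_def]
  refine integral_congr_ae ?_
  filter_upwards [Φ.memLp_divergence.coeFn_toLp] with x hx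
  simp only [divL2, LinearMap.coe_mk, AddHom.coe_mk, hx]
  simp [mul_comm]

/-- The pairing of test fields with an integrable density. -/
def crossIntegral {lam : Measure Plane} {g : Plane → Plane} (hg : Integrable g lam) :
    TestField →ₗ[ℝ] ℝ where
  toFun Φ := ∫ x, cross (Φ.1 x) (g x) ∂lam
  map_add' Φ Ψ := by
    rw [← integral_add (integrable_cross hg Φ.contDiff.continuous Φ.hasCompactSupport)
      (integrable_cross hg Ψ.contDiff.continuous Ψ.hasCompactSupport)]
    refine integral_congr_ae (Eventually.of_forall fun x => ?_)
    simp [cross]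
    ring
  map_smul' c Φ := by
    rw [RingHom.id_apply, smul_eq_mul, ← integral_const_mul]
    refine integral_congr_ae (Eventually.of_forall fun x => ?_)
    simp [cross]
    ring

end TestField

/-! ### The distributional gradient of a function of finite variation -/

/-- Dividing a nonzero field by its sup norm makes it admissible; this is the bound that the
Hahn–Banach extension needs. -/
lemma FV.abs_integral_mul_divergence_le (f : FV) (Φ : TestField) :
    |∫ x, FV.toL2 f x * divergence Φ x| ≤ ‖f‖ * ‖Φ.toBCF‖ := by
  set c := ‖Φ.toBCF‖ with hc
  have hΦ : ∀ x, ‖Φ.1 x‖ ≤ c := Φ.toBCF.norm_coe_le_norm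
  rcases eq_or_ne c 0 with h0 | h0
  · have : Φ = 0 := by
      ext1
      funext x
      simpa [h0] using hΦ x
    subst this
    have h : divergence (0 : TestField).1 = 0 := by
      funext x
      simpa using TestField.divergence_smul 0 0 x
    rw [h]
    simp [h0]
  have hpos : 0 < c := lt_of_le_of_ne (norm_nonneg _) h0.symm
  have hadm : IsAdmissible (c⁻¹ • Φ : TestField).1 :=
    ⟨(c⁻¹ • Φ : TestField).contDiff, (c⁻¹ • Φ : TestField).hasCompactSupport, fun x => by
      rw [Submodule.coe_smul, Pi.smul_apply, norm_smul, Real.norm_of_nonneg (by positivity),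
        inv_mul_le_iff₀ hpos, mul_one]
      exact hΦ x⟩
  have h := ofReal_abs_integral_le_planeVariation (FV.toL2 f) hadm
  rw [ENNReal.ofReal_le_iff_le_toReal (FV.planeVariation_lt_top f).ne, ← FV.norm_def] at h
  have e : ∫ x, FV.toL2 f x * divergence (c⁻¹ • Φ : TestField).1 x
      = c⁻¹ * ∫ x, FV.toL2 f x * divergence Φ x := by
    rw [← integral_const_mul]
    refine integral_congr_ae (Eventually.of_forall fun x => ?_)
    simp only [TestField.divergence_smul]
    ring
  rwa [e, abs_mul, abs_of_pos (inv_pos.2 hpos), inv_mul_le_iff₀ hpos, mul_comm] at h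

/-- For `f ∈ FV(ℝ²)` the measure `∇^⊥ f` exists, and `|∇^⊥ f|(ℝ²) ≤ V(f)`. -/
theorem FV.exists_isPerpGradient (f : FV) :
    ∃ μ : PlaneMeasure, IsPerpGradient (FV.toL2 f) μ ∧ μ.variation.real univ ≤ ‖f‖ := by
  obtain ⟨G, hGn, hG⟩ := exists_strongDual_comp_eq TestField.toBCF
    ((innerSL ℝ (FV.toL2 f)).toLinearMap.comp TestField.divL2) (norm_nonneg f) (fun Φ => by
      simpa [TestField.inner_divL2] using FV.abs_integral_mul_divergence_le f Φ)
  obtain ⟨lam, h, hi, hle, hrep⟩ := exists_measure_density_of_strongDual G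
  -- This rotation turns the inner product into `cross`: `cross Φ g = ⟨Φ, h⟩`.
  let g : Plane → Plane := fun x => !₂[h x 1, -h x 0]
  have hcont : Continuous fun v : Plane => (!₂[v 1, -v 0] : Plane) := by fun_prop
  have hnorm : ∀ x, ‖g x‖ = ‖h x‖ := fun x => norm_rotate (h x)
  have hg : Integrable g lam :=
    hi.congr' (hcont.comp_aestronglyMeasurable hi.1)
      (Eventually.of_forall fun x => (hnorm x).symm)
  refine ⟨lam.withDensityᵥ g, ?_, ?_⟩
  · rw [isPerpGradient_withDensityᵥ_iff _ hg]
    intro Φ hΦ hc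
    have h1 := hG ⟨Φ, hΦ, hc⟩
    rw [hrep _ hc] at h1
    have h2 : ((innerSL ℝ (FV.toL2 f)).toLinearMap.comp TestField.divL2) ⟨Φ, hΦ, hc⟩
        = ∫ x, FV.toL2 f x * divergence Φ x := TestField.inner_divL2 _ _
    rw [← h2, ← h1]
    refine integral_congr_ae (Eventually.of_forall fun x => ?_)
    simp only [PiLp.inner_apply, Fin.sum_univ_two, cross, g]
    have e : TestField.toBCF ⟨Φ, hΦ, hc⟩ x = Φ x := rfl
    rw [e]
    simp
    ring
  · rw [Measure.real, Measure.variation_withDensityᵥ hg, withDensity_apply _ MeasurableSet.univ,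
      Measure.restrict_univ, ← integral_norm_eq_lintegral_enorm hg.1]
    simp only [hnorm]
    exact hle.trans hGn

/-! ### The Gagliardo–Nirenberg inequality in the plane, modulo constants -/

lemma enorm_sub_le_lintegral_of_hasDerivAt {q q' : ℝ → ℝ} (h : ∀ x, HasDerivAt q (q' x) x)
    (hc : Continuous q') (a b : ℝ) : ‖q a - q b‖ₑ ≤ ∫⁻ x, ‖q' x‖ₑ := by
  rw [← intervalIntegral.integral_eq_sub_of_hasDerivAt (fun x _ => h x)
    (hc.intervalIntegrable b a), ← ofReal_norm,
    intervalIntegral.norm_intervalIntegral_eq, ofReal_norm]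
  exact (enorm_integral_le_lintegral_enorm _).trans (setLIntegral_le_lintegral _ _)

/-- The line has infinite length. This supplies horizontal and vertical lines along which `p` is
almost constant. -/
lemma exists_lt_of_lintegral_ne_top {F : ℝ → ℝ≥0∞} (h : ∫⁻ x, F x ≠ ⊤) {ε : ℝ≥0∞}
    (hε : ε ≠ 0) : ∃ x, F x < ε := by
  by_contra! hcon
  have : ∫⁻ _ : ℝ, ε ≤ ∫⁻ x, F x := lintegral_mono hcon
  rw [lintegral_const, Real.volume_univ, ENNReal.mul_top hε] at this
  exact h (top_le_iff.1 this)

/-- If `∇p` is integrable on `ℝ²`, then `p` differs from a constant by a square integrable function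
with `‖p - c‖₂² ≤ ‖∂₁p‖₁ ‖∂₂p‖₁`. -/
lemma exists_const_lintegral_sq_le {p a b : ℝ × ℝ → ℝ} (ha : Continuous a) (hb : Continuous b)
    (hpa : ∀ x y, HasDerivAt (fun s => p (s, y)) (a (x, y)) x)
    (hpb : ∀ x y, HasDerivAt (fun t => p (x, t)) (b (x, y)) y)
    (hia : ∫⁻ z, ‖a z‖ₑ ≠ ⊤) (hib : ∫⁻ z, ‖b z‖ₑ ≠ ⊤) :
    ∃ c : ℝ, ∫⁻ z, ‖p z - c‖ₑ ^ 2 ≤ (∫⁻ z, ‖a z‖ₑ) * ∫⁻ z, ‖b z‖ₑ := by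
  set F : ℝ → ℝ≥0∞ := fun y => ∫⁻ x, ‖a (x, y)‖ₑ with hF
  set H : ℝ → ℝ≥0∞ := fun x => ∫⁻ y, ‖b (x, y)‖ₑ with hH
  have hFm : Measurable F := Measurable.lintegral_prod_left' (f := fun z => ‖a z‖ₑ) (by fun_prop)
  have hHm : Measurable H := Measurable.lintegral_prod_right' (f := fun z => ‖b z‖ₑ) (by fun_prop)
  have eF : ∫⁻ z, ‖a z‖ₑ = ∫⁻ y, F y :=
    lintegral_prod_symm _ (by fun_prop : Measurable fun z => ‖a z‖ₑ).aemeasurable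
  have eH : ∫⁻ z, ‖b z‖ₑ = ∫⁻ x, H x :=
    lintegral_prod _ (by fun_prop : Measurable fun z => ‖b z‖ₑ).aemeasurable
  have hFle : ∀ x x' y, edist (p (x, y)) (p (x', y)) ≤ F y := fun x x' y => by
    rw [edist_eq_enorm_sub]
    exact enorm_sub_le_lintegral_of_hasDerivAt (fun s => hpa s y) (by fun_prop) x x'
  have hHle : ∀ x y y', edist (p (x, y)) (p (x, y')) ≤ H x := fun x y y' => by
    rw [edist_eq_enorm_sub]
    exact enorm_sub_le_lintegral_of_hasDerivAt (fun t => hpb x t) (by fun_prop) y y'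
  rw [eF] at hia
  rw [eH] at hib
  set ε : ℕ → ℝ≥0∞ := fun n => ((n : ℝ≥0∞) + 1)⁻¹ with hε
  have hε0 : ∀ n, ε n ≠ 0 := fun n => by simp [hε]
  have hεlim : Tendsto ε atTop (nhds 0) := by
    have := (tendsto_add_atTop_iff_nat 1).2 ENNReal.tendsto_inv_nat_nhds_zero
    simpa [hε] using this
  choose y hy using fun n => exists_lt_of_lintegral_ne_top hia (hε0 n)
  choose x hx using fun n => exists_lt_of_lintegral_ne_top hib (hε0 n)
  -- Two grid points are joined through a corner: along the horizontal line at height `y n`, then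
  -- along the vertical line at `x m`, where `p` oscillates by at most `ε n` and `ε m`.
  have hcauchy : CauchySeq fun n => p (x n, y n) := by
    refine EMetric.cauchySeq_iff_le_tendsto_0.2 ⟨fun n => ε n + ε n, ?_, by
      simpa using hεlim.add hεlim⟩
    have hanti : Antitone ε := fun m n hmn => by
      simp only [hε]
      gcongr
    intro n m N hn hm
    refine (edist_triangle _ (p (x m, y n)) _).trans (add_le_add ?_ ?_)
    · exact ((hFle _ _ _).trans (hy n).le).trans (hanti hn)
    · exact ((hHle _ _ _).trans (hx m).le).trans (hanti hm)
  obtain ⟨c, hc⟩ := cauchySeq_tendsto_of_complete hcauchy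
  -- Move horizontally from `(s, t)` to `(x n, t)` at cost `F t`, then vertically to `(x n, y n)` at
  -- a cost that tends to zero.
  have hcF : ∀ s t, ‖p (s, t) - c‖ₑ ≤ F t := by
    intro s t
    rw [← edist_eq_enorm_sub]
    refine le_of_tendsto_of_tendsto (tendsto_const_nhds.edist hc)
      (by simpa using tendsto_const_nhds.add hεlim : Tendsto (fun n => F t + ε n) atTop (nhds (F t)))
      (Eventually.of_forall fun n => ?_)
    exact (edist_triangle _ (p (x n, t)) _).trans
      (add_le_add (hFle _ _ _) ((hHle _ _ _).trans (hx n).le))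
  have hcH : ∀ s t, ‖p (s, t) - c‖ₑ ≤ H s := by
    intro s t
    rw [← edist_eq_enorm_sub]
    refine le_of_tendsto_of_tendsto (tendsto_const_nhds.edist hc)
      (by simpa using tendsto_const_nhds.add hεlim : Tendsto (fun n => H s + ε n) atTop (nhds (H s)))
      (Eventually.of_forall fun n => ?_)
    exact (edist_triangle _ (p (s, y n)) _).trans
      (add_le_add (hHle _ _ _) ((hFle _ _ _).trans (hy n).le))
  refine ⟨c, ?_⟩
  -- One factor of the square is bounded by a function of the first coordinate, the other by a
  -- function of the second, so the integral factorises.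
  calc ∫⁻ z, ‖p z - c‖ₑ ^ 2 ≤ ∫⁻ z : ℝ × ℝ, H z.1 * F z.2 := by
        refine lintegral_mono fun z => ?_
        rw [pow_two]
        exact mul_le_mul' (hcH z.1 z.2) (hcF z.1 z.2)
    _ = (∫⁻ x, H x) * ∫⁻ y, F y := lintegral_prod_mul hHm.aemeasurable hFm.aemeasurable
    _ = (∫⁻ z, ‖a z‖ₑ) * ∫⁻ z, ‖b z‖ₑ := by rw [eF, eH, mul_comm]

/-! ### Potentials of divergence-free fields -/

/-- The pairing `cross` as a continuous bilinear map. -/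
def crossL : Plane →L[ℝ] Plane →L[ℝ] ℝ :=
  LinearMap.mkContinuous₂ (LinearMap.mk₂ ℝ cross
    (fun _ _ _ => by simp [cross]; ring) (fun _ _ _ => by simp [cross]; ring)
    (fun _ _ _ => by simp [cross]; ring) (fun _ _ _ => by simp [cross]; ring)) 1
    fun u v => by simpa using abs_cross_le u v

@[simp] lemma crossL_apply (u v : Plane) : crossL u v = cross u v := rfl

/-- A linear vector field of trace zero is symmetric for `cross`. -/
lemma cross_symm_of_trace_eq_zero (L : Plane →L[ℝ] Plane)
    (h : ∑ i : Fin 2, L (EuclideanSpace.single i 1) i = 0) (u v : Plane) :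
    cross (L u) v = cross (L v) u := by
  have hv : ∀ v : Plane, L v = v 0 • L (EuclideanSpace.single 0 1)
      + v 1 • L (EuclideanSpace.single 1 1) := by
    intro v
    have e : v = v 0 • EuclideanSpace.single (0 : Fin 2) (1 : ℝ)
        + v 1 • EuclideanSpace.single (1 : Fin 2) (1 : ℝ) := by
      ext j; fin_cases j <;> simp
    conv_lhs => rw [e]
    simp
  rw [Fin.sum_univ_two] at h
  rw [hv u, hv v]
  simp only [cross, PiLp.add_apply, PiLp.smul_apply, smul_eq_mul]
  linear_combination (u 1 * v 0 - u 0 * v 1) * h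

/-- Points of the plane in coordinates. -/
def planeMk (z : ℝ × ℝ) : Plane := !₂[z.1, z.2]

lemma measurePreserving_planeMk : MeasurePreserving planeMk volume volume := by
  have h1 := (EuclideanSpace.volume_preserving_symm_measurableEquiv_toLp (Fin 2)).symm
  have h2 := (volume_preserving_finTwoArrow ℝ).symm
  exact h1.comp h2

lemma continuous_planeMk : Continuous planeMk := by unfold planeMk; fun_prop

lemma hasDerivAt_planeMk_fst (x y : ℝ) :
    HasDerivAt (fun s => planeMk (s, y)) (EuclideanSpace.single 0 1) x := by
  have : ∀ s, planeMk (s, y) = s • EuclideanSpace.single (0 : Fin 2) (1 : ℝ) + planeMk (0, y) := by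
    intro s
    ext j; fin_cases j <;> simp [planeMk]
  rw [funext this]
  simpa using ((hasDerivAt_id x).smul_const (EuclideanSpace.single (0 : Fin 2) (1 : ℝ))).add_const
    (planeMk (0, y))

lemma hasDerivAt_planeMk_snd (x y : ℝ) :
    HasDerivAt (fun t => planeMk (x, t)) (EuclideanSpace.single 1 1) y := by
  have : ∀ s, planeMk (x, s) = s • EuclideanSpace.single (1 : Fin 2) (1 : ℝ) + planeMk (x, 0) := by
    intro s
    ext j; fin_cases j <;> simp [planeMk]
  rw [funext this]
  simpa using ((hasDerivAt_id y).smul_const (EuclideanSpace.single (1 : Fin 2) (1 : ℝ))).add_const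
    (planeMk (x, 0))

lemma enorm_apply_le (v : Plane) (i : Fin 2) : ‖v i‖ₑ ≤ ‖v‖ₑ :=
  enorm_le_iff_norm_le.2 (PiLp.norm_apply_le v i)

/-- An integrable differentiable divergence-free field `w` on the plane is `∇^⊥ q` for a square
integrable function `q` with `‖q‖₂ ≤ ‖w‖₁`. -/
lemma exists_potential {w : Plane → Plane} (hw : Differentiable ℝ w)
    (hdiv : ∀ x, divergence w x = 0) (hi : Integrable w) :
    ∃ q : Plane → ℝ, (∀ x, HasFDerivAt q (crossL (w x)) x) ∧ MemLp q 2 volume ∧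
      eLpNorm q 2 volume ≤ ∫⁻ x, ‖w x‖ₑ := by
  have hω : ∀ x, HasFDerivAt (fun x => crossL (w x)) (crossL.comp (fderiv ℝ w x)) x := fun x =>
    crossL.hasFDerivAt.comp x (hw x).hasFDerivAt
  have hωd : DifferentiableOn ℝ (fun x => crossL (w x)) univ := fun x _ =>
    (hω x).differentiableAt.differentiableWithinAt
  -- Poincaré lemma: the one-form `crossL (w x)` is closed because `w` is divergence-free.
  obtain ⟨p, hp⟩ := convex_univ.exists_forall_hasFDerivAt_of_fderiv_symmetric (𝕜 := ℝ)
    isOpen_univ hωd (fun x _ u v => by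
      rw [(hω x).fderiv]
      exact cross_symm_of_trace_eq_zero _ (hdiv x) u v)
  have hp' : ∀ x, HasFDerivAt p (crossL (w x)) x := fun x => hp x (mem_univ x)
  have hwc := hw.continuous
  have hcomp : ∀ i : Fin 2, ∫⁻ z, ‖w (planeMk z) i‖ₑ ≤ ∫⁻ x, ‖w x‖ₑ := by
    intro i
    rw [← measurePreserving_planeMk.lintegral_comp (f := fun x => ‖w x‖ₑ) (by fun_prop)]
    exact lintegral_mono fun z => enorm_apply_le _ _
  have hfin : ∫⁻ x, ‖w x‖ₑ ≠ ⊤ := hi.2.ne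
  have hcont := continuous_planeMk
  obtain ⟨c, hc⟩ := exists_const_lintegral_sq_le (p := fun z => p (planeMk z))
    (a := fun z => w (planeMk z) 1) (b := fun z => -w (planeMk z) 0)
    (by fun_prop) (by fun_prop)
    (fun x y => by
      have h : HasDerivAt (fun s => p (planeMk (s, y))) _ x :=
        (hp' _).comp_hasDerivAt x (hasDerivAt_planeMk_fst x y)
      simpa [cross] using h)
    (fun x y => by
      have h : HasDerivAt (fun t => p (planeMk (x, t))) _ y :=
        (hp' _).comp_hasDerivAt y (hasDerivAt_planeMk_snd x y)
      simpa [cross] using h)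
    (ne_top_of_le_ne_top hfin (hcomp 1))
    (ne_top_of_le_ne_top hfin (by simpa using hcomp 0))
  have hpc : Continuous p :=
    continuous_iff_continuousAt.2 fun x => (hp' x).continuousAt
  have hle : eLpNorm (fun x => p x - c) 2 volume ≤ ∫⁻ x, ‖w x‖ₑ := by
    have h2 : eLpNorm (fun x => p x - c) 2 volume ^ (2 : ℝ) ≤ (∫⁻ x, ‖w x‖ₑ) ^ (2 : ℝ) := by
      have := eLpNorm_nnreal_pow_eq_lintegral (f := fun x => p x - c) (μ := volume)
        (p := 2) (by norm_num)
      simp only [NNReal.coe_ofNat, ENNReal.coe_ofNat] at this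
      rw [this, ← measurePreserving_planeMk.lintegral_comp (by fun_prop)]
      simp only [ENNReal.rpow_two]
      refine hc.trans ?_
      rw [pow_two]
      refine mul_le_mul' (hcomp 1) ?_
      simpa using hcomp 0
    exact (ENNReal.rpow_le_rpow_iff (by norm_num)).1 h2
  refine ⟨fun x => p x - c, fun x => (hp' x).sub_const c, ⟨by fun_prop, ?_⟩, hle⟩
  exact hle.trans_lt hi.2

/-- Integration by parts against a potential. -/
lemma integral_potential_mul_divergence {w : Plane → Plane} (hw : Continuous w) {q : Plane → ℝ}
    (hq : ∀ x, HasFDerivAt q (crossL (w x)) x) (Φ : TestField) :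
    ∫ x, q x * divergence Φ x = ∫ x, cross (Φ.1 x) (w x) := by
  have hqc : Continuous q := continuous_iff_continuousAt.2 fun x => (hq x).continuousAt
  have hΦ := fun i => contDiff_apply_plane Φ.contDiff i
  have hΦc := fun i => hasCompactSupport_apply_plane Φ.hasCompactSupport i
  have hcr : ∀ i : Fin 2, Continuous fun x => cross (w x) (EuclideanSpace.single i 1) := by
    intro i
    unfold cross
    fun_prop
  have i1 : ∀ i : Fin 2, Integrable fun x => q x * partialD i (fun y => Φ.1 y i) x := fun i =>
    (hqc.mul (continuous_partialD (hΦ i) i)).integrable_of_hasCompactSupport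
      (hasCompactSupport_partialD (hΦc i) i).mul_left
  have i2 : ∀ i : Fin 2, Integrable fun x =>
      cross (w x) (EuclideanSpace.single i 1) * Φ.1 x i := fun i =>
    ((hcr i).mul (hΦ i).continuous).integrable_of_hasCompactSupport (hΦc i).mul_left
  have i3 : ∀ i : Fin 2, Integrable fun x => q x * Φ.1 x i := fun i =>
    (hqc.mul (hΦ i).continuous).integrable_of_hasCompactSupport (hΦc i).mul_left
  have key : ∀ i : Fin 2, ∫ x, q x * partialD i (fun y => Φ.1 y i) x
      = -∫ x, cross (w x) (EuclideanSpace.single i 1) * Φ.1 x i := by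
    intro i
    have := integral_mul_fderiv_eq_neg_fderiv_mul_of_integrable (μ := volume) (f := q)
      (g := fun y => Φ.1 y i) (v := EuclideanSpace.single i 1)
      (by simpa only [(hq _).fderiv, crossL_apply] using i2 i) (i1 i) (i3 i)
      (fun x _ => (hq x).differentiableAt) (fun x _ => (hΦ i).differentiable (by simp) x)
    simpa only [(hq _).fderiv, crossL_apply, partialD] using this
  simp only [divergence_eq_partialD Φ.contDiff, mul_add]
  rw [integral_add (i1 0) (i1 1), key, key, ← neg_add, ← integral_add (i2 0) (i2 1),
    ← integral_neg]
  refine integral_congr_ae (Eventually.of_forall fun x => ?_)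
  simp [cross]
  ring

/-! ### Mollification of densities -/

section Mollify

variable {lam : Measure Plane} {g : Plane → Plane} {η : Plane → ℝ}

/-- The mollification `x ↦ ∫ η(x - y) g(y) dλ(y)` of the measure `g λ`. -/
def mollify (lam : Measure Plane) (g : Plane → Plane) (η : Plane → ℝ) (x : Plane) : Plane :=
  ∫ y, η (x - y) • g y ∂lam

lemma integrable_mollify_integrand (hg : Integrable g lam) (hη : ContDiff ℝ ∞ η)
    (hc : HasCompactSupport η) (x : Plane) : Integrable (fun y => η (x - y) • g y) lam := by
  obtain ⟨C, hC⟩ := hc.exists_bound_of_continuous hη.continuous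
  have hηc := hη.continuous
  exact hg.bdd_smul C (φ := fun y => η (x - y))
    (by fun_prop : Continuous fun y => η (x - y)).aestronglyMeasurable
    (Eventually.of_forall fun y => hC _)

lemma hasFDerivAt_mollify (hg : Integrable g lam) (hη : ContDiff ℝ ∞ η)
    (hc : HasCompactSupport η) (x : Plane) :
    Integrable (fun y => (fderiv ℝ η (x - y)).smulRight (g y)) lam ∧
    HasFDerivAt (mollify lam g η) (∫ y, (fderiv ℝ η (x - y)).smulRight (g y) ∂lam) x := by
  have hd := hη.continuous_fderiv (by simp)
  obtain ⟨C, hC⟩ := (hc.fderiv (𝕜 := ℝ)).exists_bound_of_continuous hd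
  have hm : AEStronglyMeasurable (fun y => (fderiv ℝ η (x - y)).smulRight (g y)) lam :=
    (ContinuousLinearMap.smulRightL ℝ Plane Plane).aestronglyMeasurable_comp₂
      (by fun_prop : Continuous fun y => fderiv ℝ η (x - y)).aestronglyMeasurable
      hg.aestronglyMeasurable
  have hb : ∀ x y, ‖(fderiv ℝ η (x - y)).smulRight (g y)‖ ≤ C * ‖g y‖ := fun x y => by
    rw [ContinuousLinearMap.norm_smulRight_apply]
    exact mul_le_mul_of_nonneg_right (hC _) (norm_nonneg _)
  refine ⟨(hg.norm.const_mul C).mono' hm (Eventually.of_forall (hb x)), ?_⟩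
  refine hasFDerivAt_integral_of_dominated_of_fderiv_le (s := univ) univ_mem
    (Eventually.of_forall fun z => (integrable_mollify_integrand hg hη hc z).aestronglyMeasurable)
    (integrable_mollify_integrand hg hη hc x) hm
    (Eventually.of_forall fun y z _ => hb z y) (hg.norm.const_mul C)
    (Eventually.of_forall fun y z _ => ?_)
  have h1 : HasFDerivAt (fun z => η (z - y)) (fderiv ℝ η (z - y)) z := by
    have h2 : HasFDerivAt η (fderiv ℝ η (z - y)) (z - y) :=
      (hη.differentiable (by simp) _).hasFDerivAt
    exact h2.comp z ((hasFDerivAt_id z).sub_const y)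
  exact h1.smul_const (g y)

/-- The derivative of the mollification averages rank-one maps `v ↦ (Dη v) g`, whose trace is `Dη
g`. The result pairs the measure with the gradient in `y` of `η (x - y)`, up to sign. -/
lemma divergence_mollify (hg : Integrable g lam) (hη : ContDiff ℝ ∞ η)
    (hc : HasCompactSupport η) (x : Plane) :
    divergence (mollify lam g η) x = ∫ y, fderiv ℝ η (x - y) (g y) ∂lam := by
  obtain ⟨hi, hd⟩ := hasFDerivAt_mollify hg hη hc x
  have hi' : ∀ i : Fin 2, Integrable
      (fun y => fderiv ℝ η (x - y) (EuclideanSpace.single i 1) • g y) lam := fun i =>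
    (ContinuousLinearMap.apply ℝ Plane (EuclideanSpace.single i (1 : ℝ) : Plane)).integrable_comp hi
  have hcomp : ∀ i : Fin 2, (∫ y, (fderiv ℝ η (x - y)).smulRight (g y) ∂lam)
      (EuclideanSpace.single i 1) i
      = ∫ y, fderiv ℝ η (x - y) (EuclideanSpace.single i 1) * g y i ∂lam := by
    intro i
    rw [ContinuousLinearMap.integral_apply hi]
    exact ((EuclideanSpace.proj (𝕜 := ℝ) i : Plane →L[ℝ] ℝ).integral_comp_comm (hi' i)).symm
  have hi'' : ∀ i : Fin 2, Integrable
      (fun y => fderiv ℝ η (x - y) (EuclideanSpace.single i 1) * g y i) lam := fun i =>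
    (EuclideanSpace.proj (𝕜 := ℝ) i : Plane →L[ℝ] ℝ).integrable_comp (hi' i)
  rw [divergence, hd.fderiv, Fin.sum_univ_two, hcomp, hcomp, ← integral_add (hi'' 0) (hi'' 1)]
  refine integral_congr_ae (Eventually.of_forall fun y => ?_)
  simp only [fderiv_apply_eq_partialD η _ (g y), partialD]
  ring

/-- The integrand of the mollification is integrable on the product. -/
lemma integrable_mollify_prod [SFinite lam] (hg : Integrable g lam) (hη : ContDiff ℝ ∞ η)
    (hc : HasCompactSupport η) :
    Integrable (fun z : Plane × Plane => η (z.1 - z.2) • g z.2) (volume.prod lam) := by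
  have hηc := hη.continuous
  have hm : AEStronglyMeasurable (fun z : Plane × Plane => η (z.1 - z.2) • g z.2)
      (volume.prod lam) :=
    (by fun_prop : Continuous fun z : Plane × Plane => η (z.1 - z.2)).aestronglyMeasurable.smul
      hg.aestronglyMeasurable.comp_snd
  have hηi : Integrable η := hηc.integrable_of_hasCompactSupport hc
  refine (integrable_prod_iff' hm).2 ⟨Eventually.of_forall fun y => ?_, ?_⟩
  · exact (hηi.comp_sub_right y).smul_const (g y)
  · simp only [norm_smul]
    have : ∀ y, ∫ x, ‖η (x - y)‖ * ‖g y‖ = (∫ x, ‖η x‖) * ‖g y‖ := fun y => by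
      rw [integral_mul_const, integral_sub_right_eq_self (fun x => ‖η x‖) y]
    simp only [this]
    exact hg.norm.const_mul _

/-- Tonelli and translation invariance. For a kernel of mass one, mollification does not increase
the total mass, which keeps the final estimate free of extra constants. -/
lemma lintegral_mollify_le [SFinite lam] (hg : Integrable g lam) (hη : ContDiff ℝ ∞ η) :
    ∫⁻ x, ‖mollify lam g η x‖ₑ ≤ (∫⁻ x, ‖η x‖ₑ) * ∫⁻ y, ‖g y‖ₑ ∂lam := by
  have hηc := hη.continuous
  calc ∫⁻ x, ‖mollify lam g η x‖ₑ ≤ ∫⁻ x, ∫⁻ y, ‖η (x - y)‖ₑ * ‖g y‖ₑ ∂lam := by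
        refine lintegral_mono fun x => (enorm_integral_le_lintegral_enorm _).trans ?_
        simp only [enorm_smul, le_refl]
    _ = ∫⁻ y, (∫⁻ x, ‖η (x - y)‖ₑ * ‖g y‖ₑ) ∂lam := by
        refine lintegral_lintegral_swap ?_
        exact ((by fun_prop : Continuous fun z : Plane × Plane =>
          ‖η (z.1 - z.2)‖ₑ).measurable.aemeasurable).mul
          hg.aestronglyMeasurable.comp_snd.enorm
    _ = ∫⁻ y, (∫⁻ x, ‖η x‖ₑ) * ‖g y‖ₑ ∂lam := by
        refine lintegral_congr fun y => ?_
        rw [lintegral_mul_const _ (by fun_prop : Continuous fun x => ‖η (x - y)‖ₑ).measurable,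
          lintegral_sub_right_eq_self (fun x => ‖η x‖ₑ) y]
    _ = _ := lintegral_const_mul'' _ hg.aestronglyMeasurable.enorm

/-- Mollification is symmetric for even kernels. -/
lemma integral_cross_mollify [SFinite lam] (hg : Integrable g lam) (hη : ContDiff ℝ ∞ η)
    (hc : HasCompactSupport η) (heven : ∀ x, η (-x) = η x) (Φ : TestField) :
    ∫ x, cross (Φ.1 x) (mollify lam g η x)
      = ∫ y, cross (convolution η Φ.1 (ContinuousLinearMap.lsmul ℝ ℝ) volume y) (g y) ∂lam := by
  have hηc := hη.continuous
  have hΦc := Φ.contDiff.continuous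
  obtain ⟨C, hC⟩ := Φ.hasCompactSupport.exists_bound_of_continuous hΦc
  have hprod := integrable_mollify_prod hg hη hc
  have hint : Integrable (fun z : Plane × Plane => cross (Φ.1 z.1) (η (z.1 - z.2) • g z.2))
      (volume.prod lam) := by
    refine (hprod.norm.const_mul C).mono'
      (crossL.aestronglyMeasurable_comp₂ (by fun_prop : Continuous fun z : Plane × Plane =>
        Φ.1 z.1).aestronglyMeasurable hprod.aestronglyMeasurable)
      (Eventually.of_forall fun z => ?_)
    exact (abs_cross_le _ _).trans (mul_le_mul_of_nonneg_right (hC _) (norm_nonneg _))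
  have e1 : ∀ x, cross (Φ.1 x) (mollify lam g η x)
      = ∫ y, cross (Φ.1 x) (η (x - y) • g y) ∂lam := fun x =>
    ((crossL (Φ.1 x)).integral_comp_comm (integrable_mollify_integrand hg hη hc x)).symm
  simp only [e1]
  rw [integral_integral_swap hint]
  refine integral_congr_ae (Eventually.of_forall fun y => ?_)
  have hi : Integrable fun x => η (y - x) • Φ.1 x :=
    ((by fun_prop : Continuous fun x => η (y - x)).smul hΦc).integrable_of_hasCompactSupport
      Φ.hasCompactSupport.smul_left
  have e2 : convolution η Φ.1 (ContinuousLinearMap.lsmul ℝ ℝ) volume y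
      = ∫ x, η (y - x) • Φ.1 x := by
    rw [convolution_eq_swap]
    rfl
  have e3 := (crossL.flip (g y)).integral_comp_comm hi
  simp only [ContinuousLinearMap.flip_apply, crossL_apply] at e3
  beta_reduce
  rw [e2, ← e3]
  refine integral_congr_ae (Eventually.of_forall fun x => ?_)
  have : η (x - y) = η (y - x) := by rw [← heven, neg_sub]
  simp only [this]
  simp [cross]
  ring

end Mollify

/-! ### Divergence-free measures are perpendicular gradients -/

/-- The estimate dual to the Gagliardo–Nirenberg inequality. -/
lemma abs_crossIntegral_le {μ : PlaneMeasure} (hμ : μ ∈ DivFreeMeasure) {g : Plane → Plane}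
    (hg : Integrable g μ.variation) (he : μ = μ.variation.withDensityᵥ g) (Φ : TestField) :
    |∫ x, cross (Φ.1 x) (g x) ∂μ.variation|
      ≤ (∫ x, ‖g x‖ ∂μ.variation) * ‖TestField.divL2 Φ‖ := by
  set C := ∫ x, ‖g x‖ ∂μ.variation with hC
  have hC0 : 0 ≤ C := integral_nonneg fun _ => norm_nonneg _
  refine le_of_forall_pos_le_add fun δ hδ => ?_
  set ε : ℝ := δ / (C + 1) with hε
  have hεpos : 0 < ε := by positivity
  have hεδ : ε * C ≤ δ := by
    rw [hε, div_mul_eq_mul_div, div_le_iff₀ (by positivity)]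
    nlinarith
  have hΦc := Φ.contDiff.continuous
  -- The radius of the kernel is a modulus of continuity of `Φ` for `ε`, so mollifying `Φ` changes
  -- it by at most `ε` everywhere.
  obtain ⟨r, hr, hr'⟩ := Metric.uniformContinuous_iff.1
    (hΦc.uniformContinuous_of_tendsto_cocompact Φ.hasCompactSupport.is_zero_at_infty) ε hεpos
  let bump : ContDiffBump (0 : Plane) := ⟨r / 2, r, by positivity, by linarith⟩
  set η : Plane → ℝ := bump.normed volume with hη
  have hηs : ContDiff ℝ ∞ η := bump.contDiff_normed
  have hηc : HasCompactSupport η := bump.hasCompactSupport_normed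
  have hηi : ∫⁻ x, ‖η x‖ₑ = 1 := by
    have h1 : Integrable η := hηs.continuous.integrable_of_hasCompactSupport hηc
    rw [← ofReal_integral_norm_eq_lintegral_enorm h1]
    have : ∀ x, ‖η x‖ = η x := fun x => Real.norm_of_nonneg (bump.nonneg_normed x)
    simp only [this]
    rw [hη, bump.integral_normed, ENNReal.ofReal_one]
  set w := mollify μ.variation g η with hw
  have hwd : Differentiable ℝ w := fun x => (hasFDerivAt_mollify hg hηs hηc x).2.differentiableAt
  -- Test `div μ = 0` with `y ↦ η (x - y)`.
  have hwdiv : ∀ x, divergence w x = 0 := by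
    intro x
    have hφ : ContDiff ℝ ∞ fun y => η (x - y) := hηs.comp (contDiff_const.sub contDiff_id)
    have hφc : HasCompactSupport fun y => η (x - y) := hηc.comp_homeomorph (Homeomorph.subLeft x)
    have h := hμ _ hφ hφc
    have hfd : ∀ y v, fderiv ℝ (fun y => η (x - y)) y v = -fderiv ℝ η (x - y) v := by
      intro y v
      have h1 : HasFDerivAt η (fderiv ℝ η (x - y)) (x - y) :=
        (hηs.differentiable (by simp) _).hasFDerivAt
      have h3 : HasFDerivAt (fun y => η (x - y)) _ y :=
        h1.comp y ((hasFDerivAt_id y).const_sub x)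
      rw [h3.fderiv]
      simp
    rw [measureDiv_eq_neg_integral_fderiv hg he hφ hφc] at h
    simp only [hfd, integral_neg, neg_neg] at h
    rw [hw, divergence_mollify hg hηs hηc, h]
  have hgC : ∫⁻ y, ‖g y‖ₑ ∂μ.variation = ENNReal.ofReal C :=
    (ofReal_integral_norm_eq_lintegral_enorm hg).symm
  have hwle : ∫⁻ x, ‖w x‖ₑ ≤ ENNReal.ofReal C := by
    have := lintegral_mollify_le hg hηs
    rwa [hηi, one_mul, hgC] at this
  have hwi : Integrable w := ⟨hwd.continuous.aestronglyMeasurable, hwle.trans_lt (by simp)⟩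
  obtain ⟨q, hq, hqL, hqle⟩ := exists_potential hwd hwdiv hwi
  have h1 : |∫ x, cross (Φ.1 x) (w x)| ≤ C * ‖TestField.divL2 Φ‖ := by
    have e : ∫ x, cross (Φ.1 x) (w x) = inner ℝ hqL.toLp (TestField.divL2 Φ) := by
      rw [← integral_potential_mul_divergence hwd.continuous hq, TestField.inner_divL2]
      refine integral_congr_ae ?_
      filter_upwards [hqL.coeFn_toLp] with x hx
      rw [hx]
    rw [e]
    refine (abs_real_inner_le_norm _ _).trans (mul_le_mul_of_nonneg_right ?_ (norm_nonneg _))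
    rw [Lp.norm_toLp]
    exact ENNReal.toReal_le_of_le_ofReal hC0 (hqle.trans hwle)
  -- The kernel is even, so it passes from the measure onto `Φ`; the difference is then controlled
  -- by `‖Φ - η * Φ‖ ≤ ε` and the mass `C` of `g`.
  have h2 : |∫ x, cross (Φ.1 x) (g x) ∂μ.variation - ∫ x, cross (Φ.1 x) (w x)| ≤ ε * C := by
    have hconv : Continuous (convolution η Φ.1 (ContinuousLinearMap.lsmul ℝ ℝ) volume) :=
      Φ.hasCompactSupport.continuous_convolution_right _
        (hηs.continuous.locallyIntegrable) hΦc
    have hconvc : HasCompactSupport (convolution η Φ.1 (ContinuousLinearMap.lsmul ℝ ℝ) volume) :=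
      hηc.convolution _ Φ.hasCompactSupport
    rw [hw, integral_cross_mollify hg hηs hηc (fun x => bump.normed_neg x) Φ,
      ← integral_sub (integrable_cross hg hΦc Φ.hasCompactSupport) (integrable_cross hg hconv hconvc),
      hC, ← integral_const_mul, ← Real.norm_eq_abs]
    refine norm_integral_le_of_norm_le (hg.norm.const_mul ε) (Eventually.of_forall fun x => ?_)
    have e : cross (Φ.1 x) (g x) - cross (convolution η Φ.1 (ContinuousLinearMap.lsmul ℝ ℝ) volume x)
        (g x) = cross (Φ.1 x - convolution η Φ.1 (ContinuousLinearMap.lsmul ℝ ℝ) volume x) (g x) := by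
      simp [cross]
      ring
    rw [e]
    refine (abs_cross_le _ _).trans (mul_le_mul_of_nonneg_right ?_ (norm_nonneg _))
    rw [← dist_eq_norm, dist_comm]
    exact bump.dist_normed_convolution_le hΦc.aestronglyMeasurable fun y hy => (hr' hy).le
  have h3 := abs_sub_abs_le_abs_sub (∫ x, cross (Φ.1 x) (g x) ∂μ.variation)
    (∫ x, cross (Φ.1 x) (w x))
  linarith

/-- Every divergence-free measure is the perpendicular gradient of a function in `L²`. -/
theorem exists_isPerpGradient_of_mem_divFreeMeasure {μ : PlaneMeasure} (hμ : μ ∈ DivFreeMeasure) :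
    ∃ f : Lp ℝ 2 (volume : Measure Plane), IsPerpGradient f μ := by
  obtain ⟨g, hg, he⟩ := μ.exists_density
  obtain ⟨G, -, hG⟩ := exists_strongDual_comp_eq TestField.divL2 (TestField.crossIntegral hg)
    (integral_nonneg fun _ => norm_nonneg _) (abs_crossIntegral_le hμ hg he)
  refine ⟨(InnerProductSpace.toDual ℝ _).symm G, ?_⟩
  rw [he, isPerpGradient_withDensityᵥ_iff _ hg]
  intro Φ hΦ hc
  have := hG ⟨Φ, hΦ, hc⟩
  rw [← InnerProductSpace.toDual_symm_apply (𝕜 := ℝ), TestField.inner_divL2] at this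
  exact this

/-! ### The isomorphism -/

lemma IsPerpGradient.unique {f : Plane → ℝ} {μ ν : PlaneMeasure} (hμ : IsPerpGradient f μ)
    (hν : IsPerpGradient f ν) : μ = ν :=
  PlaneMeasure.ext_of_integral_eq fun φ hφ hc => (hμ φ hφ hc).trans (hν φ hφ hc).symm

lemma IsPerpGradient.add {f₁ f₂ : Lp ℝ 2 (volume : Measure Plane)} {μ₁ μ₂ : PlaneMeasure}
    (h₁ : IsPerpGradient f₁ μ₁) (h₂ : IsPerpGradient f₂ μ₂) :
    IsPerpGradient ⇑(f₁ + f₂) (μ₁ + μ₂) := by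
  intro φ hφ hc
  rw [VectorMeasure.integral_add_vectorMeasure (integrable_variation_of_contDiff _ hφ hc)
    (integrable_variation_of_contDiff _ hφ hc), h₁ φ hφ hc, h₂ φ hφ hc]
  have e : ∀ i : Fin 2, ∫ x, (f₁ + f₂ : Lp ℝ 2 (volume : Measure Plane)) x * partialD i φ x
      = (∫ x, f₁ x * partialD i φ x) + ∫ x, f₂ x * partialD i φ x := by
    intro i
    rw [← integral_add (integrable_mul_partialD f₁ hφ hc i) (integrable_mul_partialD f₂ hφ hc i)]
    refine integral_congr_ae ?_
    filter_upwards [Lp.coeFn_add f₁ f₂] with x hx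
    rw [hx, Pi.add_apply, add_mul]
  rw [e, e]
  ext i
  fin_cases i <;> simp [add_comm]

lemma IsPerpGradient.smul {f : Lp ℝ 2 (volume : Measure Plane)} {μ : PlaneMeasure}
    (h : IsPerpGradient f μ) (c : ℝ) : IsPerpGradient ⇑(c • f) (c • μ) := by
  intro φ hφ hc
  rw [VectorMeasure.integral_smul_vectorMeasure, h φ hφ hc]
  have e : ∀ i : Fin 2, ∫ x, (c • f : Lp ℝ 2 (volume : Measure Plane)) x * partialD i φ x
      = c * ∫ x, f x * partialD i φ x := by
    intro i
    rw [← integral_const_mul]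
    refine integral_congr_ae ?_
    filter_upwards [Lp.coeFn_smul c f] with x hx
    rw [hx, Pi.smul_apply, smul_eq_mul, mul_assoc]
  rw [e, e]
  ext i
  fin_cases i <;> simp

namespace FV

/-- The measure `∇^⊥ f` of a function of finite variation. -/
def perpGradient (f : FV) : PlaneMeasure := (exists_isPerpGradient f).choose

lemma isPerpGradient_perpGradient (f : FV) : IsPerpGradient (toL2 f) (perpGradient f) :=
  (exists_isPerpGradient f).choose_spec.1

/-- The representation theorem gives one inequality, duality with admissible fields the other. -/
lemma variation_perpGradient (f : FV) : (perpGradient f).variation.real univ = ‖f‖ :=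
  le_antisymm (exists_isPerpGradient f).choose_spec.2
    (ENNReal.toReal_mono (measure_ne_top _ _) (isPerpGradient_perpGradient f).planeVariation_le)

/-- The operator `∇^⊥` as a linear isometry from `FV(ℝ²)` to `𝓙(ℝ²)`. -/
def perpGradientₗᵢ : FV →ₗᵢ[ℝ] DivFreeMeasure where
  toFun f := ⟨perpGradient f, (isPerpGradient_perpGradient f).mem_divFreeMeasure⟩
  map_add' f₁ f₂ := Subtype.ext ((isPerpGradient_perpGradient (f₁ + f₂)).unique
    (by
      rw [map_add]
      exact (isPerpGradient_perpGradient f₁).add (isPerpGradient_perpGradient f₂)))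
  map_smul' c f := Subtype.ext ((isPerpGradient_perpGradient (c • f)).unique
    (by
      rw [map_smul]
      exact (isPerpGradient_perpGradient f).smul c))
  norm_map' f := variation_perpGradient f

lemma perpGradientₗᵢ_surjective : Function.Surjective perpGradientₗᵢ := by
  intro μ
  obtain ⟨f, hf⟩ := exists_isPerpGradient_of_mem_divFreeMeasure μ.2
  -- The `L²` potential has finite variation because `V(f) ≤ |μ|(ℝ²) < ∞`.
  let F : FV := (⟨f, hf.planeVariation_le.trans_lt (measure_lt_top _ _)⟩ : fvSubmodule)
  exact ⟨F, Subtype.ext ((isPerpGradient_perpGradient F).unique hf)⟩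

end FV

end

/-- The equivalence quantifies over all measures, not only divergence-free ones, so it contains both
the existence and the uniqueness of `∇^⊥ f`. -/
theorem mainTheorem6 :
    ∃ T : FV ≃ₗᵢ[ℝ] DivFreeMeasure,
      ∀ (f : FV) (μ : PlaneMeasure),
        (T f : PlaneMeasure) = μ ↔ IsPerpGradient (FV.toL2 f) μ := by
  refine ⟨.ofSurjective FV.perpGradientₗᵢ FV.perpGradientₗᵢ_surjective, fun f μ => ⟨?_, ?_⟩⟩
  · rintro rfl
    exact FV.isPerpGradient_perpGradient f
  · exact fun h => (FV.isPerpGradient_perpGradient f).unique h
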